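/- Let $X$ and $D$ be Banach spaces with $D\hookrightarrow X$ a continuous, injective, dense and compact embedding, let $1<p<\infty$, and let $I=(a,b)$ be a bounded open interval, $-\infty<a<b<\infty$. *Maximal regularity.* For an open interval $J$ with left endpoint $\alpha\in\mathbb R$ (and possibly infinite right endpoint) let $\mathrm{MR}^p(J)=L^p(J;D)\cap W^{1,p}(J;X)$, with the norm $$\|v\|_{\mathrm{MR}^p(J)}=\bigl(\|v\|_{L^p(J;X)}^p+\|v\|_{L^p(J;D)}^p+w_J^p\,\|\tfrac{d}{dt}v\|_{L^p(J;X)}^p\bigr)^{1/p},$$ where $w_J=|J|$ if $J$ is bounded and $w_J=1$ otherwise. Let $L^\infty(J;\mathcal L(D;X))$ be the set of $A:J\to\mathcal L(D;X)$ such that for every $x\in D$ the function $A(\cdot)x:J\to X$ is Bochner measurable and essentially bounded. The class $\mathcal{MR}_p(J)$ consists of all $A\in L^\infty(J;\mathcal L(D;X))$ such that 1. for every $t\in J$ the graph norm $\|x\|_X+\|A(t)x\|_X$ is equivalent to $\|x\|_D$ on $D$; 2. there is $K\ge0$ such that for every $f\in L^p(J;X)$ the problem $\tfrac{d}{dt}v(t)+A(t)v(t)=f(t)$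 for a.e. $t\in J$, $v(\alpha)=0$, has a unique solution $v\in \mathrm{MR}^p(J)$, and $\|v\|_{\mathrm{MR}^p(J)}\le K\|f\|_{L^p(J;X)}$. The infimum of the admissible $K$ is denoted $[A]_{\mathcal{MR}_p(J)}$. An operator $B\in\mathcal L(D;X)$ belongs to $mr_p(J)$ if the constant map $t\mapsto B$ belongs to $\mathcal{MR}_p(J)$, and $[B]_{mr_p(J)}$ denotes the corresponding constant. *Relative continuity.* $RC(I;(D;X))$ is the set of all $A:[a,b]\to\mathcal L(D;X)$ such that $A(\cdot)x$ is Bochner measurable on $I$ for every $x\in D$ and such that for every $\epsilon>0$ there are $\delta>0$ and $\eta\ge0$ with $$\|A(t)x-A(s)x\|_X\le\epsilon\|x\|_D+\eta\|x\|_X\qquad\text{for all }x\in D,\ t,s\in[a,b],\ |t-s|\le\delta.$$ A family $\mathcal F\subset RC(I;(D;X))$ is relatively equicontinuous if for every $\epsilon>0$ the numbers $\delta,\eta$ can be chosen independently of $A\in\mathcal F$. **Statement.** Let $\mathcal O$ be an open subset of a metric space $\Lambda$ and let $A_\lambda:[a,b]\to\mathcal L(D;X)$, $\lambda\in\Lambda$,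 be such that - (a) for every $t\in[a,b]$: $A_\lambda(t)\in mr_p(0,\infty)$ for all $\lambda\in\mathcal O$, and $\sup_{\lambda\in\mathcal O}[A_\lambda(t)]_{mr_p(I)}<\infty$; - (b) $\{A_\lambda\}_{\lambda\in\mathcal O}\subset RC(I;(D;X))$, and this family is relatively equicontinuous; - (c) for every $t\in[a,b]$ the set $\{A_\lambda(t)\}_{\lambda\in\mathcal O}$ is bounded in $\mathcal L(D;X)$. Then $A_\lambda\in\mathcal{MR}_p(I)$ for all $\lambda\in\mathcal O$, and $\sup_{\lambda\in\mathcal O}[A_\lambda]_{\mathcal{MR}_p(I)}<\infty$. -/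

import Mathlib

open MeasureTheory Set

namespace MaxReg

noncomputable section

variable {D X : Type*} [NormedAddCommGroup D] [NormedSpace ℝ D]
  [NormedAddCommGroup X] [NormedSpace ℝ X]

/-- `w` is the weak derivative of `u` on the open set `J`:
`-∫_J φ' u = ∫_J φ w` for all `φ ∈ C_c^∞(J; ℝ)`
(used only for functions `u`, `w` in `L^p(J; X)`). -/
def IsWeakDeriv (J : Set ℝ) (u w : ℝ → X) : Prop :=
  ∀ φ : ℝ → ℝ, ContDiff ℝ ((⊤ : ℕ∞) : WithTop ℕ∞) φ → HasCompactSupport φ → tsupport φ ⊆ J →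
    (-(∫ t in J, deriv φ t • u t)) = ∫ t in J, φ t • w t

/-- `v` belongs to `L^p(J; D) ∩ W^{1,p}(J; X)`, with weak derivative `v'`, where `D` is regarded
as a subspace of `X` through the embedding `ι`. -/
structure MemMRSpace (p : ENNReal) (ι : D →L[ℝ] X) (J : Set ℝ) (v : ℝ → D) (v' : ℝ → X) :
    Prop where
  memLp_D : MemLp v p (volume.restrict J)
  memLp_X : MemLp (fun t => ι (v t)) p (volume.restrict J)
  memLp_deriv : MemLp v' p (volume.restrict J)
  weakDeriv : IsWeakDeriv J (fun t => ι (v t)) v'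

/-- The weight of the derivative in the norm of the maximal regularity space:
the length `|J|` if `J` is bounded, and `1` if `J` is unbounded. -/
def weight (J : Set ℝ) : ENNReal :=
  open Classical in if volume J = ⊤ then 1 else volume J

/-- The norm of the maximal regularity space,
`(‖v‖_{L^p(J;X)}^p + ‖v‖_{L^p(J;D)}^p + |J|^p ‖v'‖_{L^p(J;X)}^p)^{1/p}`
(without the factor `|J|^p` if `J` is unbounded), where `v'` is the weak derivative of `v`. -/
def mrNorm (p : ENNReal) (ι : D →L[ℝ] X) (J : Set ℝ) (v : ℝ → D) (v' : ℝ → X) : ENNReal :=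
  (eLpNorm (fun t => ι (v t)) p (volume.restrict J) ^ p.toReal
    + eLpNorm v p (volume.restrict J) ^ p.toReal
    + weight J ^ p.toReal * eLpNorm v' p (volume.restrict J) ^ p.toReal) ^ (1 / p.toReal)

/-- `u(a) = 0` for a function `u ∈ W^{1,p}(J; X)`, where `J` is an open interval with left
endpoint `a`: the continuous representative of `u` on the closure of `J` vanishes at `a`. -/
def VanishesAt (a : ℝ) (J : Set ℝ) (u : ℝ → X) : Prop :=
  ∃ g : ℝ → X, ContinuousOn g (closure J) ∧ u =ᵐ[volume.restrict J] g ∧ g a = 0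

/-- `v` (with weak derivative `v'`) is a solution in the maximal regularity space of the Cauchy
problem `v'(t) + A(t) v(t) = f(t)` on `J`, `v(a) = 0`; here `J` is an open interval with left
endpoint `a`. -/
structure IsSolution (p : ENNReal) (ι : D →L[ℝ] X) (a : ℝ) (J : Set ℝ) (A : ℝ → D →L[ℝ] X)
    (f : ℝ → X) (v : ℝ → D) (v' : ℝ → X) : Prop where
  mem : MemMRSpace p ι J v v'
  eqn : ∀ᵐ t ∂(volume.restrict J), v' t + A t (v t) = f t
  init : VanishesAt a J (fun t => ι (v t))

/-- For every `f ∈ L^p(J; X)` the Cauchy problem has exactly one solution (up to equality almost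
everywhere) in the maximal regularity space, and its norm is at most `K ‖f‖_{L^p(J;X)}`. -/
def HasMRBound (p : ENNReal) (ι : D →L[ℝ] X) (a : ℝ) (J : Set ℝ) (A : ℝ → D →L[ℝ] X)
    (K : NNReal) : Prop :=
  ∀ f : ℝ → X, MemLp f p (volume.restrict J) →
    ∃ (v : ℝ → D) (v' : ℝ → X), IsSolution p ι a J A f v v' ∧
      (∀ (u : ℝ → D) (u' : ℝ → X), IsSolution p ι a J A f u u' → u =ᵐ[volume.restrict J] v) ∧
      mrNorm p ι J v v' ≤ (K : ENNReal) * eLpNorm f p (volume.restrict J)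

/-- The graph norm `‖x‖_X + ‖B x‖_X` on `D` is equivalent to the norm of `D`. -/
def GraphNormEquiv (ι : D →L[ℝ] X) (B : D →L[ℝ] X) : Prop :=
  ∃ c C : ℝ, 0 < c ∧ 0 < C ∧ ∀ x : D, c * ‖x‖ ≤ ‖ι x‖ + ‖B x‖ ∧ ‖ι x‖ + ‖B x‖ ≤ C * ‖x‖

/-- The autonomous class `mr_p(J)`. -/
def MemAutMR (p : ENNReal) (ι : D →L[ℝ] X) (a : ℝ) (J : Set ℝ) (B : D →L[ℝ] X) : Prop :=
  GraphNormEquiv ι B ∧ ∃ K : NNReal, HasMRBound p ι a J (fun _ => B) K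

/-- `A` belongs to `L^∞(J; L(D; X))`: for every `x ∈ D` the function `A(·)x` is Bochner
measurable and essentially bounded on `J`. -/
def MemLinftyOp (J : Set ℝ) (A : ℝ → D →L[ℝ] X) : Prop :=
  ∀ x : D, MemLp (fun t => A t x) ⊤ (volume.restrict J)

/-- The nonautonomous class `MR_p(J)`. -/
def MemMR (p : ENNReal) (ι : D →L[ℝ] X) (a : ℝ) (J : Set ℝ) (A : ℝ → D →L[ℝ] X) : Prop :=
  MemLinftyOp J A ∧ (∀ t ∈ J, GraphNormEquiv ι (A t)) ∧ ∃ K : NNReal, HasMRBound p ι a J A K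

/-- The maximal regularity constant of `A` on `J`: the infimum of all admissible `K`
(equal to `∞` if there is none). -/
def mrConst (p : ENNReal) (ι : D →L[ℝ] X) (a : ℝ) (J : Set ℝ) (A : ℝ → D →L[ℝ] X) : ENNReal :=
  ⨅ (K : NNReal) (_ : HasMRBound p ι a J A K), (K : ENNReal)

/-- The maximal regularity constant of an autonomous operator. -/
def autMRConst (p : ENNReal) (ι : D →L[ℝ] X) (a : ℝ) (J : Set ℝ) (B : D →L[ℝ] X) : ENNReal :=
  mrConst p ι a J (fun _ => B)

/-- For all `x ∈ D` and `t, s ∈ [a, b]` with `|t - s| ≤ δ`: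
`‖A(t)x - A(s)x‖_X ≤ ε ‖x‖_D + η ‖x‖_X`. -/
def RelContBound (ι : D →L[ℝ] X) (a b : ℝ) (A : ℝ → D →L[ℝ] X) (ε δ η : ℝ) : Prop :=
  ∀ x : D, ∀ t ∈ Icc a b, ∀ s ∈ Icc a b, |t - s| ≤ δ →
    ‖A t x - A s x‖ ≤ ε * ‖x‖ + η * ‖ι x‖

/-- The class `RC(I; (D; X))` of relatively continuous operators, `I = (a, b)`. -/
def RelCont (ι : D →L[ℝ] X) (a b : ℝ) (A : ℝ → D →L[ℝ] X) : Prop :=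
  (∀ x : D, AEStronglyMeasurable (fun t => A t x) (volume.restrict (Ioo a b))) ∧
    ∀ ε : ℝ, 0 < ε → ∃ δ η : ℝ, 0 < δ ∧ 0 ≤ η ∧ RelContBound ι a b A ε δ η

/-- A family of relatively continuous operators is relatively equicontinuous if `δ` and `η` can
be chosen independently of the member of the family. -/
def RelEquicont (ι : D →L[ℝ] X) (a b : ℝ) (F : Set (ℝ → D →L[ℝ] X)) : Prop :=
  (∀ A ∈ F, RelCont ι a b A) ∧
    ∀ ε : ℝ, 0 < ε → ∃ δ η : ℝ, 0 < δ ∧ 0 ≤ η ∧ ∀ A ∈ F, RelContBound ι a b A ε δ η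

end

end MaxReg

/-! Near a time t₀ the problem is a small perturbation of the one with frozen operator A(t₀).
Relative continuity bounds A(t)x - A(t₀)x by ε‖x‖_D + η‖x‖_X. Solutions vanish at the left endpoint,
so on an interval of length ℓ their L^p(X) norm is at most ℓ times that of the derivative, and the
perturbation has size ε + ηℓ relative to the solution. When this is small against the frozen
constant, a contraction on right-hand sides gives maximal regularity (`HasIntegralMRBound.perturb`).
The frozen constant does not deteriorate on short intervals, because autonomous problems can be
translated and extended by zero (`HasIntegralMRBound.of_length_le`).

Compactness cuts [a, b] into finitely many such intervals. Neighbours are joined by reflecting the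
left solution across the common endpoint and correcting it by a solution with zero initial value
(`HasIntegralMRBound.glue`). The constants at each stage depend only on data common to the family,
hence the uniformity in λ.

The argument runs on pairs (v, v') with v(t) = ∫_a^t v', normed in L^p(D × X); the lemma of du
Bois-Reymond makes this equivalent to the weak formulation. -/

namespace MaxReg

/-! ### Weak derivatives and primitives -/

section WeakDerivative

variable {X : Type*} [NormedAddCommGroup X] [NormedSpace ℝ X]

/-- A smooth function with integral zero, supported in a compact subset of `(a, b)`, has a primitive
of the same kind. -/
theorem exists_primitive_of_integral_eq_zero {a b : ℝ} {χ : ℝ → ℝ}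
    (hχ : ContDiff ℝ ((⊤ : ℕ∞) : WithTop ℕ∞) χ) {S : Set ℝ} (hS : IsCompact S) (hne : S.Nonempty)
    (hSab : S ⊆ Ioo a b) (hχS : ∀ t, t ∉ S → χ t = 0) (hint : ∫ t, χ t = 0) :
    ∃ φ : ℝ → ℝ, ContDiff ℝ ((⊤ : ℕ∞) : WithTop ℕ∞) φ ∧ HasCompactSupport φ ∧
      tsupport φ ⊆ Ioo a b ∧ ∀ t, deriv φ t = χ t := by
  obtain ⟨a', ha', hmin⟩ := hS.exists_isLeast hne
  obtain ⟨b', hb', hmax⟩ := hS.exists_isGreatest hne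
  have hderiv : ∀ t, HasDerivAt (fun t => ∫ s in a'..t, χ s) (χ t) t := fun t =>
    intervalIntegral.integral_hasDerivAt_right (hχ.continuous.intervalIntegrable _ _)
      (hχ.continuous.stronglyMeasurableAtFilter _ _) hχ.continuous.continuousAt
  have hsupp : Function.support (fun t => ∫ s in a'..t, χ s) ⊆ Icc a' b' := by
    intro t ht
    by_contra hmem
    apply ht
    rw [mem_Icc, not_and_or, not_le, not_le] at hmem
    rcases hmem with h | h
    · refine intervalIntegral.integral_zero_ae (Filter.Eventually.of_forall fun s hs => ?_)
      rw [uIoc_of_ge h.le] at hs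
      rcases hs.2.lt_or_eq with h' | rfl
      · exact hχS s fun hsS => absurd (hmin hsS) (not_le.2 h')
      -- The minimum of `S` belongs to `S`, so `χ` vanishes there only by continuity from the left.
      · have hcl : IsClosed {s | χ s = 0} := isClosed_eq hχ.continuous continuous_const
        have : Iio s ⊆ {s | χ s = 0} := fun r hr =>
          hχS r fun hrS => absurd (hmin hrS) (not_le.2 hr)
        exact hcl.closure_subset_iff.2 this (by rw [closure_Iio]; exact mem_Iic.2 le_rfl)
    · have hle : a' ≤ t := (hmin hb').trans h.le
      show ∫ s in a'..t, χ s = 0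
      rw [intervalIntegral.integral_of_le hle, ← integral_Icc_eq_integral_Ioc,
        setIntegral_eq_integral_of_forall_compl_eq_zero, hint]
      intro s hs
      refine hχS s fun hsS => hs ⟨hmin hsS, (hmax hsS).trans h.le⟩
  have hts : tsupport (fun t => ∫ s in a'..t, χ s) ⊆ Icc a' b' :=
    closure_minimal hsupp isClosed_Icc
  refine ⟨fun t => ∫ s in a'..t, χ s, ?_, ?_, ?_, fun t => (hderiv t).deriv⟩
  · rw [contDiff_infty_iff_deriv]
    refine ⟨fun t => (hderiv t).differentiableAt, ?_⟩
    rwa [funext fun t => (hderiv t).deriv]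
  · exact isCompact_Icc.of_isClosed_subset (isClosed_tsupport _) hts
  · exact hts.trans (Icc_subset_Ioo (hSab ha').1 (hSab hb').2)

/-- The lemma of du Bois-Reymond: a function with zero weak derivative is constant. -/
theorem ae_eq_const_of_integral_deriv_smul_eq_zero [CompleteSpace X] {a b : ℝ} (hab : a < b)
    {h : ℝ → X} (hh : IntegrableOn h (Ioo a b))
    (H : ∀ φ : ℝ → ℝ, ContDiff ℝ ((⊤ : ℕ∞) : WithTop ℕ∞) φ → HasCompactSupport φ →
      tsupport φ ⊆ Ioo a b → ∫ t in Ioo a b, deriv φ t • h t = 0) :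
    ∃ C : X, ∀ᵐ t ∂(volume.restrict (Ioo a b)), h t = C := by
  have hr : (0 : ℝ) < (b - a) / 4 := by linarith
  let ψ : ContDiffBump ((a + b) / 2 : ℝ) := ⟨(b - a) / 8, (b - a) / 4, by linarith, by linarith⟩
  have hψ_supp : tsupport (ψ.normed volume) ⊆ Ioo a b := by
    rw [ψ.tsupport_normed_eq, Real.closedBall_eq_Icc]
    refine Icc_subset_Ioo ?_ ?_ <;> simp only [ψ] <;> linarith
  have hψ_smooth : ContDiff ℝ ((⊤ : ℕ∞) : WithTop ℕ∞) (ψ.normed volume) := ψ.contDiff_normed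
  have hψ_int : ∫ t, ψ.normed volume t = 1 := ψ.integral_normed
  have hsmul : ∀ g : ℝ → ℝ, Continuous g → HasCompactSupport g →
      IntegrableOn (fun t => g t • h t) (Ioo a b) := by
    intro g hg hgc
    obtain ⟨M, hM⟩ := hg.bounded_above_of_compact_support hgc
    exact hh.bdd_smul M hg.aestronglyMeasurable (Filter.Eventually.of_forall hM)
  let C : X := ∫ t in Ioo a b, ψ.normed volume t • h t
  have key : ∀ᵐ t ∂volume, t ∈ Ioo a b → h t - C = 0 := by
    refine isOpen_Ioo.ae_eq_zero_of_integral_contDiff_smul_eq_zero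
      (hh.sub (integrableOn_const (by simp))).locallyIntegrableOn ?_
    intro g hg hgc hgs
    -- Removing the mean of `g` makes `χ` the derivative of a test function, and `H` then reads ∫ g
    -- h = (∫ g) C.
    let χ : ℝ → ℝ := fun t => g t - (∫ s, g s) * ψ.normed volume t
    have hg_int : Integrable g := hg.continuous.integrable_of_hasCompactSupport hgc
    obtain ⟨φ, hφ, hφc, hφs, hφd⟩ := exists_primitive_of_integral_eq_zero (a := a) (b := b)
      (χ := χ) (hg.sub (contDiff_const.mul hψ_smooth))
      (S := tsupport g ∪ tsupport (ψ.normed volume)) (hgc.isCompact.union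
        ψ.hasCompactSupport_normed.isCompact)
      (by
        rw [ψ.tsupport_normed_eq]
        exact ⟨_, Or.inr (Metric.mem_closedBall_self hr.le)⟩)
      (union_subset hgs hψ_supp)
      (fun t ht => by
        have h1 : g t = 0 := image_eq_zero_of_notMem_tsupport fun h => ht (Or.inl h)
        have h2 : ψ.normed volume t = 0 :=
          image_eq_zero_of_notMem_tsupport fun h => ht (Or.inr h)
        simp only [χ, h1, h2, mul_zero, sub_zero])
      (by
        rw [integral_sub hg_int (ψ.integrable_normed.const_mul _), integral_const_mul, hψ_int]
        ring)
    have h0 := H φ hφ hφc hφs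
    simp only [hφd, χ, sub_smul, mul_smul] at h0
    have hψh : IntegrableOn (fun t => (∫ s, g s) • ψ.normed volume t • h t) (Ioo a b) :=
      (hsmul _ ψ.continuous_normed ψ.hasCompactSupport_normed).smul (∫ s, g s)
    rw [integral_sub (hsmul g hg.continuous hgc) hψh, integral_smul] at h0
    rw [← setIntegral_eq_integral_of_forall_compl_eq_zero (s := Ioo a b)
      (fun t ht => by
        rw [image_eq_zero_of_notMem_tsupport fun h => ht (hgs h), zero_smul])]
    simp only [smul_sub]
    rw [integral_sub (hsmul g hg.continuous hgc) (hg_int.integrableOn.smul_const C),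
      integral_smul_const, setIntegral_eq_integral_of_forall_compl_eq_zero (f := g)
      (fun t ht => image_eq_zero_of_notMem_tsupport fun h => ht (hgs h))]
    exact h0
  refine ⟨C, ?_⟩
  rw [ae_restrict_iff' measurableSet_Ioo]
  filter_upwards [key] with t ht hmem
  exact sub_eq_zero.1 (ht hmem)

/-- Integration by parts of a primitive of an integrable function against a test function. -/
theorem integral_deriv_smul_primitive [CompleteSpace X] {a b : ℝ} {w : ℝ → X}
    (hw : IntegrableOn w (Ioo a b)) {φ : ℝ → ℝ} (hφ : ContDiff ℝ ((⊤ : ℕ∞) : WithTop ℕ∞) φ)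
    (hφc : HasCompactSupport φ) (hφs : tsupport φ ⊆ Ioo a b) :
    ∫ t in Ioo a b, deriv φ t • ∫ s in a..t, w s = -∫ t in Ioo a b, φ t • w t := by
  have hd : Continuous (deriv φ) := hφ.continuous_deriv (by simp)
  have hdi : Integrable (deriv φ) (volume.restrict (Ioo a b)) :=
    (hd.integrable_of_hasCompactSupport hφc.deriv).restrict
  -- Fubini on the triangle s < t: integrating in s gives the primitive of `w`, integrating in t
  -- gives φ(b) - φ(s) = -φ(s).
  let F : ℝ → ℝ → X := fun t s => {q : ℝ × ℝ | q.2 < q.1}.indicator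
    (fun q => deriv φ q.1 • w q.2) (t, s)
  have hF : Integrable (Function.uncurry F)
      ((volume.restrict (Ioo a b)).prod (volume.restrict (Ioo a b))) :=
    (hdi.smul_prod hw).indicator (measurableSet_lt measurable_snd measurable_fst)
  have hswap := integral_integral_swap hF
  have h1 : ∀ t ∈ Ioo a b, ∫ s in Ioo a b, F t s = deriv φ t • ∫ s in a..t, w s := by
    intro t ht
    have : ∀ s, F t s = (Iio t).indicator (fun s => deriv φ t • w s) s := fun s => by
      simp only [F, indicator, mem_ofPred_eq, mem_Iio]
    simp only [this]
    rw [setIntegral_indicator measurableSet_Iio, integral_smul, Ioo_inter_Iio,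
      min_eq_right ht.2.le, intervalIntegral.integral_of_le ht.1.le, integral_Ioc_eq_integral_Ioo]
  have h2 : ∀ s ∈ Ioo a b, ∫ t in Ioo a b, F t s = -(φ s • w s) := by
    intro s hs
    have : ∀ t, F t s = (Ioi s).indicator (fun t => deriv φ t • w s) t := fun t => by
      simp only [F, indicator, mem_ofPred_eq, mem_Ioi]
    simp only [this]
    rw [setIntegral_indicator measurableSet_Ioi, integral_smul_const, inter_comm, Ioi_inter_Ioo,
      max_eq_left hs.1.le, ← integral_Ioc_eq_integral_Ioo,
      ← intervalIntegral.integral_of_le hs.2.le,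
      intervalIntegral.integral_deriv_eq_sub
        (fun t _ => (hφ.differentiable (by simp)).differentiableAt) (hd.intervalIntegrable _ _),
      image_eq_zero_of_notMem_tsupport (x := b) fun h => (hφs h).2.ne rfl, zero_sub, neg_smul]
  rw [setIntegral_congr_fun measurableSet_Ioo h1, setIntegral_congr_fun measurableSet_Ioo h2,
    integral_neg] at hswap
  exact hswap

end WeakDerivative

/-! ### Integral formulation of the Cauchy problem -/

section IntegralSolution

variable {D X : Type*} [NormedAddCommGroup D] [NormedSpace ℝ D]
  [NormedAddCommGroup X] [NormedSpace ℝ X]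

/-- `z = (v, v')` solves `v' + A v = f` on `(a, c)`, `v(a) = 0`, where the conditions on the weak
derivative and on the initial value are expressed by `v(t) = ∫_a^t v'`. -/
structure IsIntegralSolution (p : ENNReal) (ι : D →L[ℝ] X) (a c : ℝ) (A : ℝ → D →L[ℝ] X)
    (f : ℝ → X) (z : ℝ → D × X) : Prop where
  memLp : MemLp z p (volume.restrict (Ioo a c))
  eqn : ∀ᵐ t ∂(volume.restrict (Ioo a c)), (z t).2 + A t (z t).1 = f t
  primitive : ∀ᵐ t ∂(volume.restrict (Ioo a c)), ι (z t).1 = ∫ s in a..t, (z s).2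

/-- Solvability of the Cauchy problem on `(a, c)` together with an a priori estimate; by linearity
the estimate contains the uniqueness of solutions. -/
structure HasIntegralMRBound (p : ENNReal) (ι : D →L[ℝ] X) (a c : ℝ) (A : ℝ → D →L[ℝ] X)
    (K : ℝ) : Prop where
  exists_solution : ∀ f : ℝ → X, MemLp f p (volume.restrict (Ioo a c)) →
    ∃ z, IsIntegralSolution p ι a c A f z
  bound : ∀ (f : ℝ → X) (z : ℝ → D × X), MemLp f p (volume.restrict (Ioo a c)) →
    IsIntegralSolution p ι a c A f z →
      lpNorm z p (volume.restrict (Ioo a c)) ≤ K * lpNorm f p (volume.restrict (Ioo a c))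

variable {p : ENNReal} {ι : D →L[ℝ] X} {a c : ℝ} {A : ℝ → D →L[ℝ] X} {f : ℝ → X}

omit [NormedSpace ℝ X] in
theorem integrableOn_Icc_of_memLp_Ioo {w : ℝ → X} (hp : 1 ≤ p)
    (hw : MemLp w p (volume.restrict (Ioo a c))) : IntegrableOn w (Icc a c) :=
  (integrableOn_Icc_iff_integrableOn_Ioo (by simp) (by simp)).2 (hw.integrable hp)

theorem IsIntegralSolution.isSolution [CompleteSpace X] (hp : 1 ≤ p) (hac : a < c)
    {z : ℝ → D × X} (h : IsIntegralSolution p ι a c A f z) :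
    IsSolution p ι a (Ioo a c) A f (fun t => (z t).1) (fun t => (z t).2) := by
  have hint : IntegrableOn (fun t => (z t).2) (Icc a c) :=
    integrableOn_Icc_of_memLp_Ioo hp h.memLp.snd
  refine ⟨⟨h.memLp.fst, ι.comp_memLp' h.memLp.fst, h.memLp.snd, ?_⟩, h.eqn, ?_⟩
  · intro φ hφ hφc hφs
    rw [← neg_neg (∫ t in Ioo a c, φ t • (z t).2), ← integral_deriv_smul_primitive
      (hint.mono_set Ioo_subset_Icc_self) hφ hφc hφs, neg_inj]
    refine integral_congr_ae ?_
    filter_upwards [h.primitive] with t ht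
    rw [ht]
  · refine ⟨fun t => ∫ s in a..t, (z s).2, ?_, h.primitive, intervalIntegral.integral_same⟩
    rw [closure_Ioo hac.ne]
    rw [← uIcc_of_le hac.le] at hint ⊢
    exact intervalIntegral.continuousOn_primitive_interval hint

/-- By du Bois-Reymond, ιv and the primitive of v' differ by a constant. The continuous
representative fixes it: equality almost everywhere becomes equality on the closed interval, and
evaluation at `a` gives zero. -/
theorem IsSolution.isIntegralSolution [CompleteSpace X] (hp : 1 ≤ p) (hac : a < c) {v : ℝ → D}
    {v' : ℝ → X} (h : IsSolution p ι a (Ioo a c) A f v v') :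
    IsIntegralSolution p ι a c A f (fun t => (v t, v' t)) := by
  refine ⟨memLp_prod_iff.2 ⟨h.mem.memLp_D, h.mem.memLp_deriv⟩, h.eqn, ?_⟩
  have hint : IntegrableOn v' (Icc a c) :=
    integrableOn_Icc_of_memLp_Ioo hp h.mem.memLp_deriv
  have hcont : ContinuousOn (fun t => ∫ s in a..t, v' s) (Icc a c) := by
    rw [← uIcc_of_le hac.le] at hint ⊢
    exact intervalIntegral.continuousOn_primitive_interval hint
  have hvi : IntegrableOn (fun t => ι (v t)) (Ioo a c) := h.mem.memLp_X.integrable hp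
  have hpi : IntegrableOn (fun t => ∫ s in a..t, v' s) (Ioo a c) :=
    (hcont.integrableOn_compact isCompact_Icc).mono_set Ioo_subset_Icc_self
  obtain ⟨C, hC⟩ := ae_eq_const_of_integral_deriv_smul_eq_zero hac
    (h := fun t => ι (v t) - ∫ s in a..t, v' s) (hvi.sub hpi) (by
      intro φ hφ hφc hφs
      obtain ⟨M, hM⟩ := (hφ.continuous_deriv (by simp)).bounded_above_of_compact_support hφc.deriv
      have hm := (hφ.continuous_deriv (by simp)).aestronglyMeasurable
        (μ := volume.restrict (Ioo a c))
      have hφv : IntegrableOn (fun t => deriv φ t • ι (v t)) (Ioo a c) :=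
        hvi.bdd_smul M hm (Filter.Eventually.of_forall hM)
      have hφp : IntegrableOn (fun t => deriv φ t • ∫ s in a..t, v' s) (Ioo a c) :=
        hpi.bdd_smul M hm (Filter.Eventually.of_forall hM)
      simp only [smul_sub]
      rw [integral_sub hφv hφp,
        integral_deriv_smul_primitive (hint.mono_set Ioo_subset_Icc_self) hφ hφc hφs,
        sub_neg_eq_add, ← h.mem.weakDeriv φ hφ hφc hφs, add_neg_cancel])
  obtain ⟨g, hg, hvg, hga⟩ := h.init
  rw [closure_Ioo hac.ne] at hg
  have heq : EqOn g (fun t => C + ∫ s in a..t, v' s) (Icc a c) := by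
    refine Measure.eqOn_Icc_of_ae_eq volume hac.ne ?_ hg (continuousOn_const.add hcont)
    rw [Measure.restrict_congr_set Ioo_ae_eq_Icc.symm]
    filter_upwards [hC, hvg] with t h1 h2
    rw [← h2, ← h1, sub_add_cancel]
  have hC0 : C = 0 := by
    have := heq (left_mem_Icc.2 hac.le)
    simp only [hga, intervalIntegral.integral_same, add_zero] at this
    exact this.symm
  filter_upwards [hC] with t ht
  rw [hC0] at ht
  exact sub_eq_zero.1 ht

/-- Application of a strongly measurable family of operators to a measurable function. -/
theorem aestronglyMeasurable_clm_apply {α : Type*} [MeasurableSpace α] {μ : Measure α}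
    {A : α → D →L[ℝ] X} {v : α → D} (hA : ∀ x, AEStronglyMeasurable (fun t => A t x) μ)
    (hv : AEStronglyMeasurable v μ) : AEStronglyMeasurable (fun t => A t (v t)) μ := by
  obtain ⟨w, hw, hvw⟩ := hv
  -- For simple `s` the function is a finite sum of indicators of `A(·)y`; the general case is a
  -- pointwise limit, by continuity of each `A t`. Only strong measurability of `A` enters.
  have hsimple : ∀ s : SimpleFunc α D, AEStronglyMeasurable (fun t => A t (s t)) μ := by
    intro s
    have : (fun t => A t (s t)) =
        fun t => ∑ y ∈ s.range, (s ⁻¹' {y}).indicator (fun t => A t y) t := by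
      funext t
      rw [Finset.sum_eq_single (s t)]
      · rw [indicator_of_mem (by simp)]
      · intro y _ hy
        exact indicator_of_notMem (fun h => hy (by simpa using h.symm)) _
      · intro h
        exact absurd (s.mem_range_self t) h
    rw [this]
    exact Finset.aestronglyMeasurable_fun_sum _ fun y _ =>
      (hA y).indicator (s.measurableSet_fiber y)
  have hlim : AEStronglyMeasurable (fun t => A t (w t)) μ :=
    aestronglyMeasurable_of_tendsto_ae Filter.atTop (fun n => hsimple (hw.approx n))
      (Filter.Eventually.of_forall fun t =>
        ((A t).continuous.tendsto _).comp (hw.tendsto_approx t))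
  refine hlim.congr ?_
  filter_upwards [hvw] with t ht
  rw [ht]

end IntegralSolution

/-! ### Real-valued L^p norms on intervals -/

section Lp

variable {α E F : Type*} [MeasurableSpace α] {μ : Measure α} [NormedAddCommGroup E]
  [NormedAddCommGroup F] {p : ENNReal}

/-- Membership of `g` in L^p matters: the real-valued norm turns an infinite norm into 0. -/
theorem lpNorm_le_mul_of_ae_le {f : α → E} {g : α → F} {C : ℝ} (hC : 0 ≤ C) (hg : MemLp g p μ)
    (hf : AEStronglyMeasurable f μ) (h : ∀ᵐ t ∂μ, ‖f t‖ ≤ C * ‖g t‖) :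
    lpNorm f p μ ≤ C * lpNorm g p μ := by
  rw [← toReal_eLpNorm hf, ← toReal_eLpNorm hg.1, ← ENNReal.toReal_ofReal_mul _ _ hC]
  exact ENNReal.toReal_mono (ENNReal.mul_ne_top ENNReal.ofReal_ne_top hg.2.ne)
    (eLpNorm_le_mul_eLpNorm_of_ae_le_mul h p)

theorem lpNorm_le_of_ae_le {f : α → E} {g : α → F} (hg : MemLp g p μ)
    (hf : AEStronglyMeasurable f μ) (h : ∀ᵐ t ∂μ, ‖f t‖ ≤ ‖g t‖) : lpNorm f p μ ≤ lpNorm g p μ := by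
  simpa using lpNorm_le_mul_of_ae_le zero_le_one hg hf (by simpa using h)

theorem lpNorm_congr_ae {f g : α → E} (hf : AEStronglyMeasurable f μ) (h : f =ᵐ[μ] g) :
    lpNorm f p μ = lpNorm g p μ := by
  rw [← toReal_eLpNorm hf, ← toReal_eLpNorm (hf.congr h), eLpNorm_congr_ae h]

theorem lpNorm_mono_measure {f : α → E} {ν : Measure α} (hf : MemLp f p ν) (h : μ ≤ ν) :
    lpNorm f p μ ≤ lpNorm f p ν := by
  rw [← toReal_eLpNorm hf.1, ← toReal_eLpNorm (hf.1.mono_measure h)]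
  exact ENNReal.toReal_mono hf.2.ne (eLpNorm_mono_measure f h)

theorem lpNorm_comp_measurePreserving {β : Type*} [MeasurableSpace β] {ν : Measure β} {f : β → E}
    {τ : α → β} (hf : AEStronglyMeasurable f ν) (hτ : MeasurePreserving τ μ ν) :
    lpNorm (fun t => f (τ t)) p μ = lpNorm f p ν := by
  change lpNorm (f ∘ τ) p μ = _
  rw [← toReal_eLpNorm hf, ← toReal_eLpNorm (hf.comp_measurePreserving hτ)]
  exact congrArg _ (eLpNorm_comp_measurePreserving hf hτ)

theorem lpNorm_indicator {f : α → E} {s : Set α} (hs : MeasurableSet s)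
    (hf : AEStronglyMeasurable f (μ.restrict s)) :
    lpNorm (s.indicator f) p μ = lpNorm f p (μ.restrict s) := by
  rw [← toReal_eLpNorm hf, ← toReal_eLpNorm ((aestronglyMeasurable_indicator_iff hs).2 hf),
    eLpNorm_indicator_eq_eLpNorm_restrict hs]

/-- The p-th powers add, and x ↦ x^(1/p) is subadditive for p ≥ 1. This serves to cut an interval in
two. -/
theorem eLpNorm_add_measure_le {f : α → E} {ν : Measure α} (hp : 1 ≤ p) (hp' : p ≠ ⊤) :
    eLpNorm f p (μ + ν) ≤ eLpNorm f p μ + eLpNorm f p ν := by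
  have h0 : p ≠ 0 := (zero_lt_one.trans_le hp).ne'
  have h1 : 1 ≤ p.toReal := by simpa using ENNReal.toReal_mono hp' hp
  simp only [eLpNorm_eq_lintegral_rpow_enorm_toReal h0 hp', lintegral_add_measure]
  exact ENNReal.rpow_add_le_add_rpow _ _ (by positivity)
    ((div_le_one (by positivity)).2 h1)

theorem memLp_add_measure {f : α → E} {ν : Measure α} (hp : 1 ≤ p) (hp' : p ≠ ⊤)
    (hμ : MemLp f p μ) (hν : MemLp f p ν) : MemLp f p (μ + ν) :=
  ⟨aestronglyMeasurable_add_measure_iff.2 ⟨hμ.1, hν.1⟩,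
    (eLpNorm_add_measure_le hp hp').trans_lt (ENNReal.add_lt_top.2 ⟨hμ.2, hν.2⟩)⟩

theorem lpNorm_add_measure_le {f : α → E} {ν : Measure α} (hp : 1 ≤ p) (hp' : p ≠ ⊤)
    (hμ : MemLp f p μ) (hν : MemLp f p ν) :
    lpNorm f p (μ + ν) ≤ lpNorm f p μ + lpNorm f p ν := by
  rw [← toReal_eLpNorm (memLp_add_measure hp hp' hμ hν).1, ← toReal_eLpNorm hμ.1,
    ← toReal_eLpNorm hν.1, ← ENNReal.toReal_add hμ.2.ne hν.2.ne]
  exact ENNReal.toReal_mono (ENNReal.add_lt_top.2 ⟨hμ.2, hν.2⟩).ne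
    (eLpNorm_add_measure_le hp hp')

theorem restrict_Ioo_eq_add {a c d : ℝ} (hac : a ≤ c) (hcd : c ≤ d) :
    (volume : Measure ℝ).restrict (Ioo a d) =
      volume.restrict (Ioo a c) + volume.restrict (Ioo c d) := by
  simp only [Measure.restrict_congr_set Ioo_ae_eq_Ioc]
  rw [← Ioc_union_Ioc_eq_Ioc hac hcd, Measure.restrict_union (Ioc_disjoint_Ioc_of_le le_rfl)
    measurableSet_Ioc]

theorem measurePreserving_sub_Ioo (a c h : ℝ) : MeasurePreserving (fun t => t - h)
    (volume.restrict (Ioo (a + h) (c + h))) (volume.restrict (Ioo a c)) := by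
  have := (measurePreserving_sub_right volume h).restrict_preimage
    (measurableSet_Ioo (a := a) (b := c))
  rwa [preimage_sub_const_Ioo] at this

theorem measurePreserving_reflect (c : ℝ) :
    MeasurePreserving (fun t : ℝ => c - t) volume volume :=
  Measure.measurePreserving_sub_left volume c

/-- The primitive is bounded by the L^1 norm of `g`, which Hölder bounds by (c - a)^(1 - 1/p) times
its L^p norm; the L^p norm of a constant supplies the missing (c - a)^(1/p). The dominating `g`
allows `w` to be one component of a pair. -/
theorem lpNorm_primitive_le {E : Type*} [NormedAddCommGroup E] [NormedSpace ℝ E] {a c : ℝ}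
    {u w : ℝ → E} {F : Type*} [NormedAddCommGroup F] {g : ℝ → F} (hp : 1 ≤ p) (hp' : p ≠ ⊤)
    (hac : a ≤ c)
    (hg : MemLp g p (volume.restrict (Ioo a c)))
    (hw : AEStronglyMeasurable w (volume.restrict (Ioo a c))) (hwg : ∀ t, ‖w t‖ ≤ ‖g t‖)
    (hu : AEStronglyMeasurable u (volume.restrict (Ioo a c)))
    (h : ∀ᵐ t ∂(volume.restrict (Ioo a c)), u t = ∫ s in a..t, w s) :
    lpNorm u p (volume.restrict (Ioo a c)) ≤ (c - a) * lpNorm g p (volume.restrict (Ioo a c)) := by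
  have hvol : (volume.restrict (Ioo a c)) univ = ENNReal.ofReal (c - a) := by simp
  have h0 : p ≠ 0 := (zero_lt_one.trans_le hp).ne'
  have hpr : 0 < p.toReal := ENNReal.toReal_pos h0 hp'
  have hg1 : MemLp g 1 (volume.restrict (Ioo a c)) := hg.mono_exponent hp
  have hb : ∀ᵐ t ∂(volume.restrict (Ioo a c)),
      ‖u t‖ ≤ (eLpNorm g 1 (volume.restrict (Ioo a c))).toReal := by
    filter_upwards [h, ae_restrict_mem measurableSet_Ioo] with t ht hmem
    rw [ht, toReal_eLpNorm hg1.1, lpNorm_one_eq_integral_norm hg1.1,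
      intervalIntegral.integral_of_le hmem.1.le]
    refine (norm_integral_le_integral_norm _).trans ?_
    rw [integral_Ioc_eq_integral_Ioo]
    have hgi : IntegrableOn (fun t => ‖g t‖) (Ioo a c) := (memLp_one_iff_integrable.1 hg1).norm
    refine (setIntegral_mono_set (f := fun t => ‖w t‖) (t := Ioo a c) ?_ ?_ ?_).trans ?_
    · exact hgi.mono' hw.norm (by simpa using Filter.Eventually.of_forall hwg)
    · exact Filter.Eventually.of_forall fun _ => norm_nonneg _
    · exact (Ioo_subset_Ioo_right hmem.2.le).eventuallyLE
    · exact integral_mono_of_nonneg (Filter.Eventually.of_forall fun _ => norm_nonneg _) hgi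
        (Filter.Eventually.of_forall hwg)
  have hfin : eLpNorm g p (volume.restrict (Ioo a c)) *
      ENNReal.ofReal (c - a) ^ (1 - 1 / p.toReal) ≠ ⊤ := by
    refine ENNReal.mul_ne_top hg.2.ne (ENNReal.rpow_ne_top_of_nonneg ?_ ENNReal.ofReal_ne_top)
    have h1 : 1 ≤ p.toReal := by simpa using ENNReal.toReal_mono hp' hp
    rw [sub_nonneg, div_le_one hpr]
    exact h1
  have hkey : eLpNorm u p (volume.restrict (Ioo a c)) ≤
      ENNReal.ofReal (c - a) * eLpNorm g p (volume.restrict (Ioo a c)) := by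
    rcases hac.eq_or_lt with rfl | hlt
    · simp
    refine (eLpNorm_le_of_ae_bound hb).trans ?_
    rw [hvol, ENNReal.ofReal_toReal hg1.2.ne]
    have h2 := eLpNorm_le_eLpNorm_mul_rpow_measure_univ hp hg.1
    rw [hvol, ENNReal.toReal_one, div_one] at h2
    refine (mul_le_mul_right h2 _).trans (le_of_eq ?_)
    rw [mul_comm (eLpNorm g p _), ← mul_assoc, ← ENNReal.rpow_add _ _ (by simpa using hlt)
      ENNReal.ofReal_ne_top]
    simp
  rw [← toReal_eLpNorm hu, ← toReal_eLpNorm hg.1,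
    ← ENNReal.toReal_ofReal_mul _ _ (sub_nonneg.2 hac)]
  exact ENNReal.toReal_mono (ENNReal.mul_ne_top ENNReal.ofReal_ne_top hg.2.ne) hkey

end Lp

/-! ### Restriction, translation and extension of solutions -/

section IntegralSolution

variable {D X : Type*} [NormedAddCommGroup D] [NormedSpace ℝ D]
  [NormedAddCommGroup X] [NormedSpace ℝ X]

variable {p : ENNReal} {ι : D →L[ℝ] X} {a c : ℝ} {A : ℝ → D →L[ℝ] X} {f : ℝ → X}
  {z : ℝ → D × X}

theorem IsIntegralSolution.intervalIntegrable (h : IsIntegralSolution p ι a c A f z) (hp : 1 ≤ p)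
    {s t : ℝ} (hs : s ∈ Icc a c) (ht : t ∈ Icc a c) :
    IntervalIntegrable (fun r => (z r).2) volume s t := by
  have hint : IntegrableOn (fun r => (z r).2) (Icc a c) :=
    integrableOn_Icc_of_memLp_Ioo hp h.memLp.snd
  exact (hint.mono_set (uIcc_subset_Icc hs ht)).intervalIntegrable

theorem IsIntegralSolution.sub (hp : 1 ≤ p) {g : ℝ → X} {y : ℝ → D × X}
    (hz : IsIntegralSolution p ι a c A f z) (hy : IsIntegralSolution p ι a c A g y) :
    IsIntegralSolution p ι a c A (f - g) (z - y) := by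
  refine ⟨hz.memLp.sub hy.memLp, ?_, ?_⟩
  · filter_upwards [hz.eqn, hy.eqn] with t h1 h2
    simp only [Pi.sub_apply, Prod.snd_sub, Prod.fst_sub, map_sub, ← h1, ← h2]
    abel
  · filter_upwards [hz.primitive, hy.primitive, ae_restrict_mem measurableSet_Ioo] with t h1 h2 hm
    have ha : a ∈ Icc a c := left_mem_Icc.2 (hm.1.le.trans hm.2.le)
    have ht : t ∈ Icc a c := Ioo_subset_Icc_self hm
    simp only [Pi.sub_apply, Prod.snd_sub, Prod.fst_sub, map_sub]
    rw [intervalIntegral.integral_sub (hz.intervalIntegrable hp ha ht)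
      (hy.intervalIntegrable hp ha ht), h1, h2]

theorem IsIntegralSolution.mono_right (h : IsIntegralSolution p ι a c A f z) {d : ℝ} (hd : d ≤ c) :
    IsIntegralSolution p ι a d A f z := by
  have hle : (volume : Measure ℝ).restrict (Ioo a d) ≤ volume.restrict (Ioo a c) :=
    Measure.restrict_mono (Ioo_subset_Ioo_right hd) le_rfl
  exact ⟨h.memLp.mono_measure hle, ae_mono hle h.eqn, ae_mono hle h.primitive⟩

theorem IsIntegralSolution.congr_right (h : IsIntegralSolution p ι a c A f z) {g : ℝ → X}
    (hfg : ∀ t ∈ Ioo a c, f t = g t) : IsIntegralSolution p ι a c A g z := by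
  refine ⟨h.memLp, ?_, h.primitive⟩
  filter_upwards [h.eqn, ae_restrict_mem measurableSet_Ioo] with t ht hm
  rw [ht, hfg t hm]

theorem IsIntegralSolution.comp_sub (h : IsIntegralSolution p ι a c A f z) (r : ℝ) :
    IsIntegralSolution p ι (a + r) (c + r) (fun t => A (t - r)) (fun t => f (t - r))
      (fun t => z (t - r)) := by
  have hmp := measurePreserving_sub_Ioo a c r
  refine ⟨h.memLp.comp_measurePreserving hmp, hmp.quasiMeasurePreserving.ae h.eqn, ?_⟩
  filter_upwards [hmp.quasiMeasurePreserving.ae h.primitive] with t ht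
  rw [ht, intervalIntegral.integral_comp_sub_right (fun s => (z s).2), add_sub_cancel_right]

theorem IsIntegralSolution.memLp_indicator (h : IsIntegralSolution p ι a c A f z) :
    MemLp ((Ioo a c).indicator z) p volume :=
  (memLp_indicator_iff_restrict measurableSet_Ioo).2 h.memLp

/-- The extension of a solution by zero is the primitive of its derivative up to time `c`. -/
theorem IsIntegralSolution.indicator_primitive (h : IsIntegralSolution p ι a c A f z)
    {a₀ : ℝ} (ha : a₀ ≤ a) :
    ∀ᵐ t, a₀ < t → t < c → ι ((Ioo a c).indicator z t).1 =
      ∫ s in a₀..t, ((Ioo a c).indicator z s).2 := by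
  have hprim := h.primitive
  rw [ae_restrict_iff' measurableSet_Ioo] at hprim
  filter_upwards [hprim, Measure.ae_ne volume a] with t ht hta ha₀ htc
  have hind : ∀ s, ((Ioo a c).indicator z s).2 = (Ioo a c).indicator (fun s => (z s).2) s := by
    intro s
    by_cases hs : s ∈ Ioo a c
    · simp only [indicator_of_mem hs]
    · simp only [indicator_of_notMem hs, Prod.snd_zero]
  simp only [hind]
  rw [intervalIntegral.integral_of_le ha₀.le, setIntegral_indicator measurableSet_Ioo]
  rcases hta.lt_or_gt with hlt | hgt
  · have hempty : Ioc a₀ t ∩ Ioo a c = ∅ := by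
      ext s
      simp only [mem_inter_iff, mem_Ioc, mem_Ioo, mem_empty_iff_false, iff_false]
      intro hs
      linarith [hs.1.2, hs.2.1]
    rw [indicator_of_notMem (fun hm => hm.1.not_gt hlt), hempty]
    simp
  · have hset : Ioc a₀ t ∩ Ioo a c = Ioc a t := by
      ext s
      simp only [mem_inter_iff, mem_Ioc, mem_Ioo]
      constructor
      · exact fun hs => ⟨hs.2.1, hs.1.2⟩
      · exact fun hs => ⟨⟨ha.trans_lt hs.1, hs.2⟩, hs.1, hs.2.trans_lt htc⟩
    rw [indicator_of_mem (show t ∈ Ioo a c from ⟨hgt, htc⟩), ht ⟨hgt, htc⟩, hset,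
      intervalIntegral.integral_of_le hgt.le]

/-- The zero initial value excludes a jump at `a`, so extending v' by zero still gives the
derivative; where v = 0 the values of `A` are irrelevant. -/
theorem IsIntegralSolution.extend_left (h : IsIntegralSolution p ι a c A f z) {a₀ : ℝ}
    (ha : a₀ ≤ a) :
    IsIntegralSolution p ι a₀ c A ((Ioo a c).indicator f) ((Ioo a c).indicator z) := by
  refine ⟨h.memLp_indicator.restrict _, ?_, ?_⟩
  · have := h.eqn
    rw [ae_restrict_iff' measurableSet_Ioo] at this
    filter_upwards [ae_restrict_of_ae this] with t ht
    by_cases hm : t ∈ Ioo a c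
    · simp only [indicator_of_mem hm, ht hm]
    · simp only [indicator_of_notMem hm, Prod.snd_zero, Prod.fst_zero, map_zero, add_zero]
  · filter_upwards [ae_restrict_of_ae (h.indicator_primitive ha),
      ae_restrict_mem measurableSet_Ioo] with t ht hm
    exact ht hm.1 hm.2

theorem lpNorm_indicator_restrict {E : Type*} [NormedAddCommGroup E] {g : ℝ → E} {a₀ : ℝ}
    (hg : AEStronglyMeasurable g (volume.restrict (Ioo a c))) (ha : a₀ ≤ a) {d : ℝ} (hd : c ≤ d) :
    lpNorm ((Ioo a c).indicator g) p (volume.restrict (Ioo a₀ d)) =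
      lpNorm g p (volume.restrict (Ioo a c)) := by
  have hset : Ioo a c ∩ Ioo a₀ d = Ioo a c := inter_eq_left.2 (Ioo_subset_Ioo ha hd)
  rw [lpNorm_indicator measurableSet_Ioo] <;>
    rw [Measure.restrict_restrict measurableSet_Ioo, hset]
  exact hg

/-- An autonomous operator inherits the maximal regularity bound on shorter intervals. -/
theorem HasIntegralMRBound.of_length_le {B : D →L[ℝ] X} {K b : ℝ}
    (h : HasIntegralMRBound p ι a b (fun _ => B) K) {α β : ℝ} (hlen : β - α ≤ b - a) :
    HasIntegralMRBound p ι α β (fun _ => B) K := by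
  constructor
  · intro f hf
    -- For existence the left endpoints are aligned: `f` is extended by zero to the right and the
    -- solution is cut off.
    have hmp := measurePreserving_sub_Ioo α β (a - α)
    have hβ : β + (a - α) ≤ b := by linarith
    rw [add_sub_cancel] at hmp
    obtain ⟨z, hz⟩ := h.exists_solution
      ((Ioo a (β + (a - α))).indicator fun t => f (t - (a - α)))
      (((memLp_indicator_iff_restrict measurableSet_Ioo).2
        (hf.comp_measurePreserving hmp)).restrict _)
    refine ⟨fun t => z (t - (α - a)), ?_⟩
    have hsol := ((hz.mono_right hβ).congr_right
      (g := fun t => f (t - (a - α))) fun t ht => indicator_of_mem ht _).comp_sub (α - a)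
    have e1 : a + (α - a) = α := by ring
    have e2 : β + (a - α) + (α - a) = β := by ring
    have e3 : ∀ t : ℝ, t - (α - a) - (a - α) = t := fun t => by ring
    simpa only [e1, e2, e3] using hsol
  · intro f z hf hz
    -- For the estimate the right endpoints are aligned: a given solution extends by zero to the
    -- left, without change of norm, to a solution on all of (a, b).
    have hmp := measurePreserving_sub_Ioo α β (b - β)
    have hα : a ≤ α + (b - β) := by linarith
    have hext := (hz.comp_sub (b - β)).extend_left hα
    have e1 : β + (b - β) = b := by ring
    rw [e1] at hext hmp
    have hfm : MemLp (fun t => f (t - (b - β))) p _ := hf.comp_measurePreserving hmp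
    have hzm : MemLp (fun t => z (t - (b - β))) p _ := hz.memLp.comp_measurePreserving hmp
    have hb := h.bound _ _ (((memLp_indicator_iff_restrict measurableSet_Ioo).2 hfm).restrict _)
      hext
    rw [lpNorm_indicator_restrict hzm.1 hα le_rfl, lpNorm_indicator_restrict hfm.1 hα le_rfl] at hb
    rwa [← lpNorm_comp_measurePreserving hf.1 hmp, ← lpNorm_comp_measurePreserving hz.memLp.1 hmp]

/-- A solution on `(a, c)` extends beyond `c` to a function in the maximal regularity space, by
reflection. -/
theorem IsIntegralSolution.exists_extension (hp : 1 ≤ p)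
    (h : IsIntegralSolution p ι a c A f z) (hac : a ≤ c) :
    ∃ w : ℝ → D × X, MemLp w p volume ∧
      lpNorm w p volume ≤ lpNorm z p (volume.restrict (Ioo a c)) ∧
      (∀ s t, IntervalIntegrable (fun r => (w r).2) volume s t) ∧
      ∀ᵐ t, c < t → ι (w t).1 = (∫ s in a..c, (z s).2) + ∫ s in c..t, (w s).2 := by
  set Z := (Ioo a c).indicator z with hZ
  have hZm : MemLp Z p volume := h.memLp_indicator
  have hmp := measurePreserving_reflect (2 * c)
  -- Reflection in time changes the sign of the derivative.
  let R : D × X → D × X := fun y => (y.1, -y.2)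
  have hRm : Continuous R := by fun_prop
  have hRn : ∀ y, ‖R y‖ = ‖y‖ := fun y => by simp [R, Prod.norm_def]
  have hZc := hZm.comp_measurePreserving hmp
  have hwm : AEStronglyMeasurable (fun t => R (Z (2 * c - t))) volume :=
    hRm.comp_aestronglyMeasurable hZc.1
  have hii : ∀ s t, IntervalIntegrable (fun r => (Z r).2) volume s t := by
    intro s t
    have hloc : LocallyIntegrable (fun r => (Z r).2) volume :=
      (hZm.snd.locallyIntegrable hp)
    exact (hloc.integrableOn_isCompact isCompact_uIcc).intervalIntegrable
  have hwLp : MemLp (fun t => R (Z (2 * c - t))) p volume :=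
    hZc.of_le hwm (Filter.Eventually.of_forall fun t => (hRn _).le)
  refine ⟨fun t => R (Z (2 * c - t)), hwLp, ?_, ?_, ?_⟩
  · refine (lpNorm_le_of_ae_le hZc hwm
      (Filter.Eventually.of_forall fun t => (hRn _).le)).trans (le_of_eq ?_)
    exact (lpNorm_comp_measurePreserving hZm.1 hmp).trans
      (lpNorm_indicator measurableSet_Ioo h.memLp.1)
  · intro s t
    exact ((hwLp.snd.locallyIntegrable hp).integrableOn_isCompact
      isCompact_uIcc).intervalIntegrable
  -- The zero extension satisfies the primitive identity below `a` too, so its reflection satisfies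
  -- it for all t > c.
  · have hout : ∀ᵐ t, t < c → ι (Z t).1 = ∫ s in a..t, (Z s).2 := by
      filter_upwards [h.indicator_primitive le_rfl, Measure.ae_ne volume a] with t ht hta htc
      rcases hta.lt_or_gt with hlt | hgt
      · have hz : ∀ s ∈ uIcc a t, (Z s).2 = 0 := fun s hs => by
          rw [uIcc_of_ge hlt.le] at hs
          rw [hZ, indicator_of_notMem (fun hm => hm.1.not_ge hs.2), Prod.snd_zero]
        rw [intervalIntegral.integral_congr hz, hZ,
          indicator_of_notMem (fun hm => hm.1.not_gt hlt)]
        simp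
      · exact ht hgt htc
    filter_upwards [hmp.quasiMeasurePreserving.ae hout] with t ht htc
    have h1 : ∫ s in a..c, (z s).2 = ∫ s in a..c, (Z s).2 := by
      rw [intervalIntegral.integral_of_le hac, intervalIntegral.integral_of_le hac,
        integral_Ioc_eq_integral_Ioo, integral_Ioc_eq_integral_Ioo]
      refine setIntegral_congr_fun measurableSet_Ioo fun s hs => ?_
      simp only [hZ, indicator_of_mem hs]
    have h2 : ∫ s in c..t, (R (Z (2 * c - s))).2 = -∫ s in (2 * c - t)..c, (Z s).2 := by
      simp only [R]
      rw [intervalIntegral.integral_neg,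
        intervalIntegral.integral_comp_sub_left (fun s => (Z s).2)]
      congr 3
      ring
    rw [h1, h2, ← sub_eq_add_neg, ← intervalIntegral.integral_add_adjacent_intervals
      (hii a (2 * c - t)) (hii _ c), add_sub_cancel_right]
    exact ht (by linarith)

end IntegralSolution

/-! ### Relatively bounded perturbations -/

section Perturbation

variable {D X : Type*} [NormedAddCommGroup D] [NormedSpace ℝ D]
  [NormedAddCommGroup X] [NormedSpace ℝ X]

variable {p : ENNReal} {ι : D →L[ℝ] X} {a c : ℝ} {A B : ℝ → D →L[ℝ] X} {f : ℝ → X}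
  {z : ℝ → D × X}

theorem IsIntegralSolution.lpNorm_embedding_le (h : IsIntegralSolution p ι a c A f z) (hp : 1 ≤ p)
    (hp' : p ≠ ⊤) (hac : a ≤ c) :
    lpNorm (fun t => ι (z t).1) p (volume.restrict (Ioo a c)) ≤
      (c - a) * lpNorm z p (volume.restrict (Ioo a c)) :=
  lpNorm_primitive_le hp hp' hac h.memLp h.memLp.snd.1 (fun _ => norm_snd_le _)
    (ι.comp_memLp' h.memLp.fst).1 h.primitive

theorem memLp_relBounded_apply {ε η : ℝ} {v : ℝ → D} (C : ℝ → D →L[ℝ] X)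
    (hC : ∀ x, AEStronglyMeasurable (fun t => C t x) (volume.restrict (Ioo a c)))
    (hb : ∀ t ∈ Ioo a c, ∀ x, ‖C t x‖ ≤ ε * ‖x‖ + η * ‖ι x‖)
    (hv : MemLp v p (volume.restrict (Ioo a c))) :
    MemLp (fun t => C t (v t)) p (volume.restrict (Ioo a c)) := by
  refine ((hv.norm.const_mul ε).add ((ι.comp_memLp' hv).norm.const_mul η)).mono'
    (aestronglyMeasurable_clm_apply hC hv.1) ?_
  filter_upwards [ae_restrict_mem measurableSet_Ioo] with t ht
  exact hb t ht (v t)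

theorem IsIntegralSolution.lpNorm_relBounded_apply_le {ε η : ℝ} (hε : 0 ≤ ε) (hη : 0 ≤ η)
    (C : ℝ → D →L[ℝ] X)
    (hC : ∀ x, AEStronglyMeasurable (fun t => C t x) (volume.restrict (Ioo a c)))
    (hb : ∀ t ∈ Ioo a c, ∀ x, ‖C t x‖ ≤ ε * ‖x‖ + η * ‖ι x‖)
    (h : IsIntegralSolution p ι a c A f z) (hp : 1 ≤ p) (hp' : p ≠ ⊤) (hac : a ≤ c) :
    lpNorm (fun t => C t (z t).1) p (volume.restrict (Ioo a c)) ≤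
      (ε + η * (c - a)) * lpNorm z p (volume.restrict (Ioo a c)) := by
  have hv := h.memLp.fst
  have hιv : MemLp (fun t => ι (z t).1) p _ := ι.comp_memLp' hv
  have h1 : lpNorm (fun t => C t (z t).1) p (volume.restrict (Ioo a c)) ≤
      lpNorm ((fun t => ε * ‖(z t).1‖) + fun t => η * ‖ι (z t).1‖) p
        (volume.restrict (Ioo a c)) := by
    refine lpNorm_le_of_ae_le ((hv.norm.const_mul ε).add (hιv.norm.const_mul η))
      (aestronglyMeasurable_clm_apply hC hv.1) ?_
    filter_upwards [ae_restrict_mem measurableSet_Ioo] with t ht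
    rw [Pi.add_apply, Real.norm_of_nonneg (by positivity)]
    exact hb t ht _
  have h2 : lpNorm (fun t => ε * ‖(z t).1‖) p (volume.restrict (Ioo a c)) ≤
      ε * lpNorm z p (volume.restrict (Ioo a c)) := by
    refine lpNorm_le_mul_of_ae_le hε h.memLp (hv.norm.const_mul ε).1
      (Filter.Eventually.of_forall fun t => ?_)
    rw [Real.norm_of_nonneg (by positivity)]
    exact mul_le_mul_of_nonneg_left (norm_fst_le _) hε
  have h3 : lpNorm (fun t => η * ‖ι (z t).1‖) p (volume.restrict (Ioo a c)) ≤
      η * lpNorm (fun t => ι (z t).1) p (volume.restrict (Ioo a c)) := by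
    refine lpNorm_le_mul_of_ae_le hη hιv (hιv.norm.const_mul η).1
      (Filter.Eventually.of_forall fun t => ?_)
    rw [Real.norm_of_nonneg (by positivity)]
  have h4 := mul_le_mul_of_nonneg_left (h.lpNorm_embedding_le hp hp' hac) hη
  have h5 := h1.trans (lpNorm_add_le (hv.norm.const_mul ε) hp)
  linarith

/-- Maximal regularity is stable under small relatively bounded perturbations. -/
theorem HasIntegralMRBound.perturb [CompleteSpace X] {K ε η : ℝ}
    (h : HasIntegralMRBound p ι a c B K)
    (hp : 1 ≤ p) (hp' : p ≠ ⊤) (hac : a ≤ c) (hK : 0 ≤ K) (hε : 0 ≤ ε) (hη : 0 ≤ η)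
    (hAB : ∀ x, AEStronglyMeasurable (fun t => (A t - B t) x) (volume.restrict (Ioo a c)))
    (hb : ∀ t ∈ Ioo a c, ∀ x, ‖(A t - B t) x‖ ≤ ε * ‖x‖ + η * ‖ι x‖)
    (hsmall : K * (ε + η * (c - a)) ≤ 1 / 2) : HasIntegralMRBound p ι a c A (2 * K) := by
  set μ := (volume : Measure ℝ).restrict (Ioo a c)
  have hsum : 0 ≤ ε + η * (c - a) := by
    have := sub_nonneg.2 hac
    positivity
  constructor
  · intro f hf
    have : Fact (1 ≤ p) := ⟨hp⟩
    choose S hS using fun g : Lp X p μ => h.exists_solution g (Lp.memLp g)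
    have hR : ∀ g, MemLp (fun t => (A t - B t) (S g t).1) p μ := fun g =>
      memLp_relBounded_apply _ hAB hb (hS g).memLp.fst
    -- With `S` solving the problem for `B`, the function `S g` solves the one for `A` exactly when
    -- g = f - (A - B) S g. `S` is chosen arbitrarily; the a priori bound applied to differences of
    -- solutions gives the Lipschitz estimate.
    let Φ : Lp X p μ → Lp X p μ := fun g => hf.toLp f - (hR g).toLp _
    have hΦ : ContractingWith (1 / 2) Φ := by
      refine ⟨by norm_num, LipschitzWith.of_dist_le_mul fun g₁ g₂ => ?_⟩
      have hdiff := (hS g₂).sub hp (hS g₁)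
      have hN := h.bound _ _ ((Lp.memLp g₂).sub (Lp.memLp g₁)) hdiff
      have hA := hdiff.lpNorm_relBounded_apply_le hε hη _ hAB hb hp hp' hac
      have e1 : Φ g₁ - Φ g₂ = ((hR g₂).sub (hR g₁)).toLp _ := by
        rw [MemLp.toLp_sub (hR g₂) (hR g₁)]
        simp only [Φ, sub_sub_sub_cancel_left]
      have e2 : dist g₁ g₂ = lpNorm (⇑g₂ - ⇑g₁) p μ := by
        rw [dist_comm, dist_eq_norm, Lp.norm_def, eLpNorm_congr_ae (Lp.coeFn_sub g₂ g₁),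
          toReal_eLpNorm ((Lp.memLp g₂).sub (Lp.memLp g₁)).1]
      have e3 : (fun t => (A t - B t) ((S g₂ - S g₁) t).1) =
          (fun t => (A t - B t) (S g₂ t).1) - fun t => (A t - B t) (S g₁ t).1 := by
        funext t
        simp only [Pi.sub_apply, Prod.fst_sub, map_sub]
      rw [e3] at hA
      rw [dist_eq_norm, e1, Lp.norm_toLp, toReal_eLpNorm ((hR g₂).sub (hR g₁)).1, e2]
      refine hA.trans ((mul_le_mul_of_nonneg_left hN hsum).trans ?_)
      have := mul_le_mul_of_nonneg_right hsmall
        (lpNorm_nonneg (f := ⇑g₂ - ⇑g₁) (p := p) (μ := μ))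
      push_cast
      linarith
    have hfix : Φ (hΦ.fixedPoint Φ) = hΦ.fixedPoint Φ := hΦ.fixedPoint_isFixedPt
    set g := hΦ.fixedPoint Φ
    refine ⟨S g, (hS g).memLp, ?_, (hS g).primitive⟩
    have e : ⇑g =ᵐ[μ] fun t => f t - (A t - B t) (S g t).1 := by
      conv_lhs => rw [← hfix]
      filter_upwards [Lp.coeFn_sub (hf.toLp f) ((hR g).toLp _), hf.coeFn_toLp,
        (hR g).coeFn_toLp] with t h1 h2 h3
      rw [h1, Pi.sub_apply, h2, h3]
    filter_upwards [(hS g).eqn, e] with t h1 h2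
    rw [h2] at h1
    simp only [_root_.sub_apply] at h1
    rw [← add_right_cancel_iff (a := (B t) (S g t).1), add_right_comm, h1]
    abel
  · intro f z hf hz
    have hR : MemLp (fun t => (A t - B t) (z t).1) p μ :=
      memLp_relBounded_apply _ hAB hb hz.memLp.fst
    -- The term (A - B)z is moved to the right-hand side; its contribution, at most half the norm of
    -- `z`, is absorbed, which doubles `K`.
    have hzB : IsIntegralSolution p ι a c B (f - fun t => (A t - B t) (z t).1) z := by
      refine ⟨hz.memLp, ?_, hz.primitive⟩
      filter_upwards [hz.eqn] with t ht
      rw [Pi.sub_apply, ← ht, _root_.sub_apply]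
      abel
    have h1 := h.bound _ _ (hf.sub hR) hzB
    have h2 := lpNorm_sub_le (g := fun t => (A t - B t) (z t).1) hf hp
    have h3 := hz.lpNorm_relBounded_apply_le hε hη _ hAB hb hp hp' hac
    have h4 := mul_le_mul_of_nonneg_right hsmall (lpNorm_nonneg (f := z) (p := p) (μ := μ))
    have h5 := mul_le_mul_of_nonneg_left (h2.trans (add_le_add_right h3 _)) hK
    linarith

end Perturbation

/-! ### Gluing adjacent intervals -/

section Gluing

variable {D X : Type*} [NormedAddCommGroup D] [NormedSpace ℝ D]
  [NormedAddCommGroup X] [NormedSpace ℝ X]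

variable {p : ENNReal} {ι : D →L[ℝ] X} {a c d : ℝ} {A : ℝ → D →L[ℝ] X} {f : ℝ → X}
  {z : ℝ → D × X}

theorem norm_snd_add_apply_le {B : D →L[ℝ] X} {M : ℝ} (hB : ∀ x, ‖B x‖ ≤ M * ‖x‖) (hM : 0 ≤ M)
    (y : D × X) : ‖y.2 + B y.1‖ ≤ (1 + M) * ‖y‖ := by
  have h1 := mul_le_mul_of_nonneg_left (norm_fst_le y) hM
  linarith [norm_add_le y.2 (B y.1), hB y.1, norm_snd_le y]

theorem memLp_snd_add_apply {M : ℝ} (hM : 0 ≤ M)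
    (hA : ∀ x, AEStronglyMeasurable (fun t => A t x) (volume.restrict (Ioo c d)))
    (hAM : ∀ t ∈ Ioo c d, ∀ x, ‖A t x‖ ≤ M * ‖x‖) (hz : MemLp z p (volume.restrict (Ioo c d))) :
    MemLp (fun t => (z t).2 + A t (z t).1) p (volume.restrict (Ioo c d)) := by
  refine hz.of_le_mul (c := 1 + M)
    (hz.snd.1.add (aestronglyMeasurable_clm_apply hA hz.fst.1)) ?_
  filter_upwards [ae_restrict_mem measurableSet_Ioo] with t ht
  exact norm_snd_add_apply_le (hAM t ht) hM _

theorem lpNorm_snd_add_apply_le {M : ℝ} (hM : 0 ≤ M)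
    (hA : ∀ x, AEStronglyMeasurable (fun t => A t x) (volume.restrict (Ioo c d)))
    (hAM : ∀ t ∈ Ioo c d, ∀ x, ‖A t x‖ ≤ M * ‖x‖) (hz : MemLp z p (volume.restrict (Ioo c d))) :
    lpNorm (fun t => (z t).2 + A t (z t).1) p (volume.restrict (Ioo c d)) ≤
      (1 + M) * lpNorm z p (volume.restrict (Ioo c d)) := by
  refine lpNorm_le_mul_of_ae_le (by positivity) hz (memLp_snd_add_apply hM hA hAM hz).1 ?_
  filter_upwards [ae_restrict_mem measurableSet_Ioo] with t ht
  exact norm_snd_add_apply_le (hAM t ht) hM _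

/-- Maximal regularity on two adjacent intervals implies maximal regularity on their union. -/
theorem HasIntegralMRBound.glue {K₁ K₂ M : ℝ} (hp : 1 ≤ p) (hp' : p ≠ ⊤) (hac : a ≤ c)
    (hcd : c ≤ d) (hM : 0 ≤ M)
    (hA : ∀ x, AEStronglyMeasurable (fun t => A t x) (volume.restrict (Ioo c d)))
    (hAM : ∀ t ∈ Ioo c d, ∀ x, ‖A t x‖ ≤ M * ‖x‖) (hK₁ : 0 ≤ K₁) (hK₂ : 0 ≤ K₂)
    (h₁ : HasIntegralMRBound p ι a c A K₁) (h₂ : HasIntegralMRBound p ι c d A K₂) :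
    HasIntegralMRBound p ι a d A (K₁ + K₁ + K₂ * (1 + (1 + M) * K₁)) := by
  have hμ := restrict_Ioo_eq_add hac hcd
  have hle₁ : (volume : Measure ℝ).restrict (Ioo a c) ≤ volume.restrict (Ioo a d) :=
    Measure.restrict_mono (Ioo_subset_Ioo_right hcd) le_rfl
  have hle₂ : (volume : Measure ℝ).restrict (Ioo c d) ≤ volume.restrict (Ioo a d) :=
    Measure.restrict_mono (Ioo_subset_Ioo_left hac) le_rfl
  constructor
  · intro f hf
    obtain ⟨z₁, hz₁⟩ := h₁.exists_solution f (hf.mono_measure hle₁)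
    obtain ⟨w, hw, -, hwi, hwc⟩ := hz₁.exists_extension hp hac
    -- `w` carries the value of `z₁` at `c` across, so the correction `z₂` starts from zero and `z₂
    -- + w` continues `z₁`.
    obtain ⟨z₂, hz₂⟩ := h₂.exists_solution (f - fun t => (w t).2 + A t (w t).1)
      ((hf.mono_measure hle₂).sub (memLp_snd_add_apply hM hA hAM (hw.restrict _)))
    let z : ℝ → D × X := fun t => if t < c then z₁ t else z₂ t + w t
    have e₁ : ∀ t, t < c → z t = z₁ t := fun t ht => if_pos ht
    have e₂ : ∀ t, c ≤ t → z t = z₂ t + w t := fun t ht => if_neg ht.not_gt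
    have he₁ : z₁ =ᵐ[volume.restrict (Ioo a c)] z := by
      filter_upwards [ae_restrict_mem measurableSet_Ioo] with t ht
      exact (e₁ t ht.2).symm
    have he₂ : z₂ + w =ᵐ[volume.restrict (Ioo c d)] z := by
      filter_upwards [ae_restrict_mem measurableSet_Ioo] with t ht
      exact (e₂ t ht.1.le).symm
    have hint₁ : ∀ t ∈ Icc a c, ∫ s in a..t, (z s).2 = ∫ s in a..t, (z₁ s).2 := by
      intro t ht
      rw [intervalIntegral.integral_of_le ht.1, intervalIntegral.integral_of_le ht.1,
        integral_Ioc_eq_integral_Ioo, integral_Ioc_eq_integral_Ioo]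
      refine setIntegral_congr_fun measurableSet_Ioo fun s hs => ?_
      simp only [e₁ s (hs.2.trans_le ht.2)]
    have hint₂ : ∀ t, c ≤ t → ∫ s in c..t, (z s).2 = ∫ s in c..t, ((z₂ s).2 + (w s).2) := by
      intro t ht
      refine intervalIntegral.integral_congr fun s hs => ?_
      rw [uIcc_of_le ht] at hs
      simp only [e₂ s hs.1, Prod.snd_add]
    have hzm : MemLp z p (volume.restrict (Ioo a d)) := by
      rw [hμ]
      exact memLp_add_measure hp hp' (hz₁.memLp.ae_eq he₁)
        ((hz₂.memLp.add (hw.restrict _)).ae_eq he₂)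
    refine ⟨z, hzm, ?_, ?_⟩ <;> rw [hμ, ae_add_measure_iff] <;> constructor
    · filter_upwards [hz₁.eqn, he₁] with t h1 h2
      rw [← h2, h1]
    · filter_upwards [hz₂.eqn, he₂] with t h1 h2
      rw [← h2]
      simp only [Pi.add_apply, Pi.sub_apply, Prod.snd_add, Prod.fst_add, map_add] at h1 ⊢
      rw [add_add_add_comm, h1, sub_add_cancel]
    · filter_upwards [hz₁.primitive, he₁, ae_restrict_mem measurableSet_Ioo] with t h1 h2 hm
      rw [← h2, h1, hint₁ t (Ioo_subset_Icc_self hm)]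
    · filter_upwards [hz₂.primitive, he₂, ae_restrict_of_ae hwc,
        ae_restrict_mem measurableSet_Ioo] with t h1 h2 h3 hm
      have hzi : IntegrableOn (fun s => (z s).2) (Icc a d) :=
        integrableOn_Icc_of_memLp_Ioo hp hzm.snd
      have hz₂i := hz₂.intervalIntegrable hp (left_mem_Icc.2 hcd) (Ioo_subset_Icc_self hm)
      rw [← h2, Pi.add_apply, Prod.fst_add, map_add, h1, h3 hm.1,
        ← intervalIntegral.integral_add_adjacent_intervals (b := c)
          (hzi.mono_set (uIcc_subset_Icc ⟨le_rfl, hac.trans hcd⟩ ⟨hac, hcd⟩)).intervalIntegrable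
          (hzi.mono_set (uIcc_subset_Icc ⟨hac, hcd⟩
            ⟨hac.trans hm.1.le, hm.2.le⟩)).intervalIntegrable,
        hint₁ c (right_mem_Icc.2 hac), hint₂ t hm.1.le,
        intervalIntegral.integral_add hz₂i (hwi _ _)]
      abel
  · intro f z hf hz
    have hz₁ : IsIntegralSolution p ι a c A f z := hz.mono_right hcd
    have hf₂ := hf.mono_measure hle₂
    have hz₂m := hz.memLp.mono_measure hle₂
    have hN₁ := h₁.bound f z (hf.mono_measure hle₁) hz₁
    have hNf₁ := mul_le_mul_of_nonneg_left (lpNorm_mono_measure hf hle₁) hK₁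
    have hNf₂ := lpNorm_mono_measure hf hle₂
    obtain ⟨w, hw, hwN, hwi, hwc⟩ := hz₁.exists_extension hp hac
    have hwm := hw.restrict (Ioo c d)
    have hAw := memLp_snd_add_apply hM hA hAM hwm
    have hNw : lpNorm w p (volume.restrict (Ioo c d)) ≤
        K₁ * lpNorm f p (volume.restrict (Ioo a d)) :=
      (lpNorm_mono_measure hw Measure.restrict_le_self).trans (hwN.trans (hN₁.trans hNf₁))
    -- `z - w` vanishes at `c`, so `h₂` applies to it. The final constant adds `K₁` for (a, c), `K₁`
    -- for `w` and `K₂ * (1 + (1 + M) * K₁)` for `z - w`.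
    have hzw : IsIntegralSolution p ι c d A (f - fun t => (w t).2 + A t (w t).1) (z - w) := by
      refine ⟨hz₂m.sub hwm, ?_, ?_⟩
      · filter_upwards [ae_mono hle₂ hz.eqn] with t ht
        simp only [Pi.sub_apply, Prod.snd_sub, Prod.fst_sub, map_sub, ← ht]
        abel
      · filter_upwards [ae_mono hle₂ hz.primitive, ae_restrict_of_ae hwc,
          ae_restrict_mem measurableSet_Ioo] with t h1 h2 hm
        have hzi : ∀ s ∈ Icc a d, IntervalIntegrable (fun r => (z r).2) volume s c :=
          fun s hs => hz.intervalIntegrable hp hs ⟨hac, hcd⟩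
        have hct := (hzi t ⟨hac.trans hm.1.le, hm.2.le⟩).symm
        simp only [Pi.sub_apply, Prod.snd_sub, Prod.fst_sub, map_sub]
        rw [h1, h2 hm.1, intervalIntegral.integral_sub hct (hwi _ _),
          ← intervalIntegral.integral_add_adjacent_intervals
            (hzi a ⟨le_rfl, hac.trans hcd⟩) hct]
        abel
    have hN₂ := h₂.bound _ _ (hf₂.sub hAw) hzw
    have hsub := lpNorm_sub_le (g := fun t => (w t).2 + A t (w t).1) hf₂ hp
    have hNAw := lpNorm_snd_add_apply_le hM hA hAM hwm
    have hz_le : lpNorm z p (volume.restrict (Ioo c d)) ≤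
        lpNorm (z - w) p (volume.restrict (Ioo c d)) +
          lpNorm w p (volume.restrict (Ioo c d)) := by
      simpa using lpNorm_add_le (g := w) (hz₂m.sub hwm) hp
    have hsplit : lpNorm z p (volume.restrict (Ioo a d)) ≤
        lpNorm z p (volume.restrict (Ioo a c)) + lpNorm z p (volume.restrict (Ioo c d)) := by
      rw [hμ]
      exact lpNorm_add_measure_le hp hp' hz₁.memLp hz₂m
    have hrhs : lpNorm (f - fun t => (w t).2 + A t (w t).1) p (volume.restrict (Ioo c d)) ≤
        (1 + (1 + M) * K₁) * lpNorm f p (volume.restrict (Ioo a d)) := by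
      have := mul_le_mul_of_nonneg_left hNw (by positivity : 0 ≤ 1 + M)
      linarith
    have := mul_le_mul_of_nonneg_left hrhs hK₂
    linarith

end Gluing

/-! ### Comparison with the maximal regularity norm -/

section Conversion

variable {D X : Type*} [NormedAddCommGroup D] [NormedSpace ℝ D]
  [NormedAddCommGroup X] [NormedSpace ℝ X]

variable {p : ENNReal} {ι : D →L[ℝ] X} {a c : ℝ} {A : ℝ → D →L[ℝ] X}

theorem weight_Ioo : weight (Ioo a c) = ENNReal.ofReal (c - a) := by
  simp [weight]

theorem mrNorm_le_add (hp : 1 ≤ p) (hp' : p ≠ ⊤) (J : Set ℝ) (v : ℝ → D) (v' : ℝ → X) :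
    mrNorm p ι J v v' ≤ eLpNorm (fun t => ι (v t)) p (volume.restrict J) +
      eLpNorm v p (volume.restrict J) + weight J * eLpNorm v' p (volume.restrict J) := by
  have h1 : 1 ≤ p.toReal := by simpa using ENNReal.toReal_mono hp' hp
  have h0 : 0 < p.toReal := by positivity
  rw [mrNorm, one_div, ENNReal.rpow_inv_le_iff h0, ← ENNReal.mul_rpow_of_nonneg _ _ h0.le]
  exact (add_le_add_left (ENNReal.add_rpow_le_rpow_add _ _ h1) _).trans
    (ENNReal.add_rpow_le_rpow_add _ _ h1)

theorem eLpNorm_le_mrNorm (hp : 1 ≤ p) (hp' : p ≠ ⊤) (J : Set ℝ) (v : ℝ → D) (v' : ℝ → X) :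
    eLpNorm v p (volume.restrict J) ≤ mrNorm p ι J v v' := by
  have h0 : 0 < p.toReal := ENNReal.toReal_pos (zero_lt_one.trans_le hp).ne' hp'
  rw [mrNorm, one_div, ENNReal.le_rpow_inv_iff h0]
  exact le_add_right le_add_self

theorem weight_mul_eLpNorm_le_mrNorm (hp : 1 ≤ p) (hp' : p ≠ ⊤) (J : Set ℝ) (v : ℝ → D)
    (v' : ℝ → X) : weight J * eLpNorm v' p (volume.restrict J) ≤ mrNorm p ι J v v' := by
  have h0 : 0 < p.toReal := ENNReal.toReal_pos (zero_lt_one.trans_le hp).ne' hp'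
  rw [mrNorm, one_div, ENNReal.le_rpow_inv_iff h0, ENNReal.mul_rpow_of_nonneg _ _ h0.le]
  exact le_add_self

/-- Uniqueness carries the bound over to every solution, v' being determined by v through the
equation. The term `K / (c - a)` undoes the weight of the derivative. -/
theorem HasMRBound.hasIntegralMRBound [CompleteSpace X] (hp : 1 ≤ p) (hp' : p ≠ ⊤) (hac : a < c)
    {K : NNReal} (h : HasMRBound p ι a (Ioo a c) A K) :
    HasIntegralMRBound p ι a c A (K + K / (c - a)) := by
  constructor
  · intro f hf
    obtain ⟨v, v', hv, -⟩ := h f hf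
    exact ⟨_, hv.isIntegralSolution hp hac⟩
  · intro f z hf hz
    obtain ⟨v, v', hv, huniq, hbound⟩ := h f hf
    have hzv := huniq _ _ (hz.isSolution hp hac)
    have hzv' : (fun t => (z t).2) =ᵐ[volume.restrict (Ioo a c)] v' := by
      filter_upwards [hzv, hz.eqn, hv.eqn] with t h1 h2 h3
      rw [h1] at h2
      exact add_right_cancel (h2.trans h3.symm)
    have hfin : (K : ENNReal) * eLpNorm f p (volume.restrict (Ioo a c)) ≠ ⊤ :=
      ENNReal.mul_ne_top ENNReal.coe_ne_top hf.2.ne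
    have hb₁ : lpNorm (fun t => (z t).1) p (volume.restrict (Ioo a c)) ≤
        K * lpNorm f p (volume.restrict (Ioo a c)) := by
      rw [lpNorm_congr_ae hz.memLp.fst.1 hzv, ← toReal_eLpNorm hv.mem.memLp_D.1,
        ← toReal_eLpNorm hf.1, ← ENNReal.coe_toReal, ← ENNReal.toReal_mul]
      exact ENNReal.toReal_mono hfin ((eLpNorm_le_mrNorm hp hp' _ _ _).trans hbound)
    have hb₂ : (c - a) * lpNorm (fun t => (z t).2) p (volume.restrict (Ioo a c)) ≤
        K * lpNorm f p (volume.restrict (Ioo a c)) := by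
      rw [lpNorm_congr_ae hz.memLp.snd.1 hzv', ← toReal_eLpNorm hv.mem.memLp_deriv.1,
        ← toReal_eLpNorm hf.1, ← ENNReal.coe_toReal, ← ENNReal.toReal_mul,
        ← ENNReal.toReal_ofReal_mul _ _ (sub_pos.2 hac).le, ← weight_Ioo]
      exact ENNReal.toReal_mono hfin ((weight_mul_eLpNorm_le_mrNorm hp hp' _ _ _).trans hbound)
    have hsum : lpNorm z p (volume.restrict (Ioo a c)) ≤
        lpNorm (fun t => (z t).1) p (volume.restrict (Ioo a c)) +
          lpNorm (fun t => (z t).2) p (volume.restrict (Ioo a c)) := by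
      have h1 : lpNorm z p (volume.restrict (Ioo a c)) ≤
          lpNorm ((fun t => ‖(z t).1‖) + fun t => ‖(z t).2‖) p (volume.restrict (Ioo a c)) := by
        refine lpNorm_le_of_ae_le (hz.memLp.fst.norm.add hz.memLp.snd.norm) hz.memLp.1
          (Filter.Eventually.of_forall fun t => ?_)
        rw [Pi.add_apply, Real.norm_of_nonneg (by positivity)]
        exact norm_prod_le_iff.2 ⟨le_add_of_nonneg_right (norm_nonneg _),
          le_add_of_nonneg_left (norm_nonneg _)⟩
      have h2 := h1.trans (lpNorm_add_le hz.memLp.fst.norm hp)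
      rwa [lpNorm_norm hz.memLp.fst.1, lpNorm_norm hz.memLp.snd.1] at h2
    have hb₃ : lpNorm (fun t => (z t).2) p (volume.restrict (Ioo a c)) ≤
        K / (c - a) * lpNorm f p (volume.restrict (Ioo a c)) := by
      rw [div_mul_eq_mul_div, le_div_iff₀ (sub_pos.2 hac), mul_comm _ (c - a)]
      exact hb₂
    linarith

/-- Uniqueness is the estimate applied to a difference of solutions, whose right-hand side is zero.
The summands `‖ι‖`, `1` and `c - a` account for the three terms of the norm. -/
theorem HasIntegralMRBound.hasMRBound [CompleteSpace X] (hp : 1 ≤ p) (hp' : p ≠ ⊤) (hac : a < c)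
    {K : ℝ} (hK : 0 ≤ K) (h : HasIntegralMRBound p ι a c A K) :
    HasMRBound p ι a (Ioo a c) A ((‖ι‖ + 1 + (c - a)) * K).toNNReal := by
  intro f hf
  obtain ⟨z, hz⟩ := h.exists_solution f hf
  have hca : 0 ≤ c - a := (sub_pos.2 hac).le
  refine ⟨_, _, hz.isSolution hp hac, fun u u' hu => ?_, ?_⟩
  · have hd := (hu.isIntegralSolution hp hac).sub hp hz
    have hb := h.bound _ _ (hf.sub hf) hd
    rw [sub_self, lpNorm_zero, mul_zero] at hb
    have h0 := (lpNorm_eq_zero hd.memLp (zero_lt_one.trans_le hp).ne').1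
      (le_antisymm hb lpNorm_nonneg)
    filter_upwards [h0] with t ht
    exact sub_eq_zero.1 (congrArg Prod.fst ht)
  · have hN := h.bound f z hf hz
    have hιm : MemLp (fun t => ι (z t).1) p (volume.restrict (Ioo a c)) :=
      ι.comp_memLp' hz.memLp.fst
    have hb₀ : lpNorm (fun t => ι (z t).1) p (volume.restrict (Ioo a c)) ≤
        ‖ι‖ * lpNorm z p (volume.restrict (Ioo a c)) :=
      lpNorm_le_mul_of_ae_le (norm_nonneg _) hz.memLp hιm.1 (Filter.Eventually.of_forall fun t =>
        (ι.le_opNorm _).trans (mul_le_mul_of_nonneg_left (norm_fst_le _) (norm_nonneg _)))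
    have hb₁ : lpNorm (fun t => (z t).1) p (volume.restrict (Ioo a c)) ≤
        lpNorm z p (volume.restrict (Ioo a c)) :=
      lpNorm_le_of_ae_le hz.memLp hz.memLp.fst.1 (Filter.Eventually.of_forall fun t =>
        norm_fst_le _)
    have hb₂ : lpNorm (fun t => (z t).2) p (volume.restrict (Ioo a c)) ≤
        lpNorm z p (volume.restrict (Ioo a c)) :=
      lpNorm_le_of_ae_le hz.memLp hz.memLp.snd.1 (Filter.Eventually.of_forall fun t =>
        norm_snd_le _)
    refine (mrNorm_le_add hp hp' _ _ _).trans ?_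
    rw [weight_Ioo, ← ofReal_lpNorm hιm, ← ofReal_lpNorm hz.memLp.fst,
      ← ofReal_lpNorm hz.memLp.snd, ← ofReal_lpNorm hf, ← ENNReal.ofReal_mul hca,
      ← ENNReal.ofReal_add lpNorm_nonneg lpNorm_nonneg,
      ← ENNReal.ofReal_add (add_nonneg lpNorm_nonneg lpNorm_nonneg)
        (mul_nonneg hca lpNorm_nonneg)]
    change _ ≤ ENNReal.ofReal _ * _
    rw [← ENNReal.ofReal_mul (by positivity)]
    refine ENNReal.ofReal_le_ofReal ?_
    have h1 := mul_le_mul_of_nonneg_left hb₂ hca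
    have h2 := mul_le_mul_of_nonneg_left hN (by positivity : 0 ≤ ‖ι‖ + 1 + (c - a))
    linarith

end Conversion

/-! ### Uniform bounds for a family -/

section Family

variable {D X : Type*} [NormedAddCommGroup D] [NormedSpace ℝ D]
  [NormedAddCommGroup X] [NormedSpace ℝ X]

variable {p : ENNReal} {ι : D →L[ℝ] X} {a b : ℝ} {F : Set (ℝ → D →L[ℝ] X)}

/-- Uniform maximal regularity of a relatively equicontinuous family on short intervals around `t₀`,
obtained by freezing the coefficients at `t₀`. -/
theorem RelEquicont.exists_local_bound [CompleteSpace X] (hp : 1 ≤ p) (hp' : p ≠ ⊤)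
    (hF : RelEquicont ι a b F) {t₀ : ℝ} (ht₀ : t₀ ∈ Icc a b) {K₀ M₀ : ℝ} (hK₀ : 0 ≤ K₀)
    (hM₀ : 0 ≤ M₀)
    (hmr : ∀ A ∈ F, HasIntegralMRBound p ι a b (fun _ => A t₀) K₀) (hbd : ∀ A ∈ F, ‖A t₀‖ ≤ M₀) :
    ∃ r K M : ℝ, 0 < r ∧ 0 ≤ K ∧ 0 ≤ M ∧ ∀ α β : ℝ, α ≤ β → Icc α β ⊆ Icc a b →
      (∀ t ∈ Icc α β, |t - t₀| < r) → ∀ A ∈ F,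
        HasIntegralMRBound p ι α β A K ∧ ∀ t ∈ Icc α β, ∀ x, ‖A t x‖ ≤ M * ‖x‖ := by
  obtain ⟨δ, η, hδ, hη, hrc⟩ := hF.2 (1 / (4 * (K₀ + 1))) (by positivity)
  set ε := 1 / (4 * (K₀ + 1)) with hε
  have hε0 : 0 ≤ ε := by positivity
  have hρ : 0 < 1 / (8 * (K₀ + 1) * (η + 1)) := by positivity
  -- The interval is at most twice the radius long, so η times its length is at most ε, and K₀(ε +
  -- ε) ≤ 1/2. The added ones avoid division by zero. The third witness bounds `A t` by `A t₀` plus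
  -- the relative continuity estimate.
  refine ⟨min δ (1 / (8 * (K₀ + 1) * (η + 1))), 2 * K₀, M₀ + (ε + η * ‖ι‖), lt_min hδ hρ,
    by positivity, by positivity, ?_⟩
  intro α β hαβ hsub hball A hA
  have hdiff : ∀ t ∈ Icc α β, ∀ x, ‖A t x - A t₀ x‖ ≤ ε * ‖x‖ + η * ‖ι x‖ := fun t ht x =>
    hrc A hA x t (hsub ht) t₀ ht₀ ((hball t ht).le.trans (min_le_left _ _))
  have hα := hsub (left_mem_Icc.2 hαβ)
  have hβ := hsub (right_mem_Icc.2 hαβ)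
  constructor
  · have hlen : β - α ≤ 1 / (4 * (K₀ + 1) * (η + 1)) := by
      have h1 := (abs_lt.1 ((hball α (left_mem_Icc.2 hαβ)).trans_le (min_le_right _ _))).1
      have h2 := (abs_lt.1 ((hball β (right_mem_Icc.2 hαβ)).trans_le (min_le_right _ _))).2
      have h3 : 1 / (4 * (K₀ + 1) * (η + 1)) = 2 * (1 / (8 * (K₀ + 1) * (η + 1))) := by
        field_simp
        norm_num
      linarith
    refine ((hmr A hA).of_length_le (by linarith [hα.1, hβ.2])).perturb (ε := ε) (η := η) hp hp'
      hαβ hK₀ hε0 hη ?_ (fun t ht x => hdiff t (Ioo_subset_Icc_self ht) x) ?_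
    · intro x
      exact (((hF.1 A hA).1 x).mono_measure (Measure.restrict_mono
        (Ioo_subset_Ioo hα.1 hβ.2) le_rfl)).sub aestronglyMeasurable_const
    · have h1 : η * (β - α) ≤ (η + 1) * (1 / (4 * (K₀ + 1) * (η + 1))) :=
        mul_le_mul (by linarith) hlen (sub_nonneg.2 hαβ) (by positivity)
      have h2 : (η + 1) * (1 / (4 * (K₀ + 1) * (η + 1))) = ε := by
        rw [hε]
        field_simp
      have h3 : (K₀ + 1) * (ε + ε) = 1 / 2 := by
        rw [hε]
        field_simp
        norm_num
      have h4 : K₀ * (ε + η * (β - α)) ≤ K₀ * (ε + ε) :=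
        mul_le_mul_of_nonneg_left (by linarith) hK₀
      linarith
  · intro t ht x
    have h1 : ‖A t x‖ ≤ ‖A t x - A t₀ x‖ + ‖A t₀ x‖ := by
      simpa using norm_add_le (A t x - A t₀ x) (A t₀ x)
    have h2 := (A t₀).le_of_opNorm_le (hbd A hA) x
    have h3 := mul_le_mul_of_nonneg_left (ι.le_opNorm x) hη
    linarith [hdiff t ht x]

/-- Uniform maximal regularity of a relatively equicontinuous family whose frozen operators have
maximal regularity with constants that are uniform in the family at every time. -/
theorem RelEquicont.exists_bound [CompleteSpace X] (hp : 1 ≤ p) (hp' : p ≠ ⊤) (hab : a ≤ b)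
    (hF : RelEquicont ι a b F)
    (hmr : ∀ t ∈ Icc a b, ∃ K : ℝ, 0 ≤ K ∧
      ∀ A ∈ F, HasIntegralMRBound p ι a b (fun _ => A t) K)
    (hbd : ∀ t ∈ Icc a b, ∃ M : ℝ, 0 ≤ M ∧ ∀ A ∈ F, ‖A t‖ ≤ M) :
    ∃ K M : ℝ, 0 ≤ K ∧ 0 ≤ M ∧ ∀ A ∈ F, HasIntegralMRBound p ι a b A K ∧
      ∀ t ∈ Icc a b, ∀ x, ‖A t x‖ ≤ M * ‖x‖ := by
  have hloc : ∀ s : Icc a b, ∃ r K M : ℝ, 0 < r ∧ 0 ≤ K ∧ 0 ≤ M ∧ ∀ α β : ℝ, α ≤ β →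
      Icc α β ⊆ Icc a b → (∀ t ∈ Icc α β, |t - s| < r) → ∀ A ∈ F,
        HasIntegralMRBound p ι α β A K ∧ ∀ t ∈ Icc α β, ∀ x, ‖A t x‖ ≤ M * ‖x‖ := by
    intro s
    obtain ⟨K, hK, hK'⟩ := hmr s s.2
    obtain ⟨M, hM, hM'⟩ := hbd s s.2
    exact hF.exists_local_bound hp hp' s.2 hK hM hK' hM'
  choose r K M hr hK hM hKM using hloc
  -- The balls of local solvability cover [a, b]; `τ` is a subdivision, eventually equal to `b`,
  -- with each step inside one ball.
  obtain ⟨τ, hτ0, hτmono, ⟨m, hm⟩, hτ⟩ := exists_monotone_Icc_subset_open_cover_Icc hab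
    (c := fun s : Icc a b => Metric.ball s (r s)) (fun s => Metric.isOpen_ball)
    (fun s _ => mem_iUnion.2 ⟨s, Metric.mem_ball_self (hr s)⟩)
  -- The constants are quantified before `A`, so the induction preserves uniformity. It starts from
  -- the degenerate interval (a, a).
  have hstep : ∀ n : ℕ, ∃ K M : ℝ, 0 ≤ K ∧ 0 ≤ M ∧ ∀ A ∈ F,
      HasIntegralMRBound p ι a (τ n) A K ∧ ∀ t ∈ Icc a (τ n : ℝ), ∀ x, ‖A t x‖ ≤ M * ‖x‖ := by
    intro n
    induction n with
    | zero =>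
      have ha : a ∈ Icc a b := left_mem_Icc.2 hab
      refine ⟨_, _, hK ⟨a, ha⟩, hM ⟨a, ha⟩, ?_⟩
      rw [hτ0]
      refine hKM ⟨a, ha⟩ a a le_rfl (Icc_subset_Icc_right hab) fun t ht => ?_
      rw [Icc_self, mem_singleton_iff] at ht
      simpa [ht] using hr ⟨a, ha⟩
    | succ n ih =>
      obtain ⟨K₁, M₁, hK₁, hM₁, h₁⟩ := ih
      obtain ⟨s, hs⟩ := hτ n
      have hle : (τ n : ℝ) ≤ τ (n + 1) := hτmono n.le_succ
      have hsub : Icc (τ n : ℝ) (τ (n + 1)) ⊆ Icc a b := Icc_subset_Icc (τ n).2.1 (τ (n + 1)).2.2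
      have h₂ := hKM s (τ n) (τ (n + 1)) hle hsub fun t ht => hs (a := ⟨t, hsub ht⟩) ht
      have hK₂ := hK s
      refine ⟨_, max M₁ (M s), ?_, le_max_of_le_left hM₁, fun A hA => ⟨(h₁ A hA).1.glue hp hp'
        (τ n).2.1 hle (hM s) (fun x => ((hF.1 A hA).1 x).mono_measure (Measure.restrict_mono
          (Ioo_subset_Ioo (τ n).2.1 (τ (n + 1)).2.2) le_rfl))
        (fun t ht => (h₂ A hA).2 t (Ioo_subset_Icc_self ht)) hK₁ (hK s) (h₂ A hA).1, ?_⟩⟩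
      · have := hM s
        positivity
      · intro t ht x
        rcases le_total t (τ n) with h | h
        · exact ((h₁ A hA).2 t ⟨ht.1, h⟩ x).trans
            (mul_le_mul_of_nonneg_right (le_max_left _ _) (norm_nonneg x))
        · exact ((h₂ A hA).2 t ⟨h, ht.2⟩ x).trans
            (mul_le_mul_of_nonneg_right (le_max_right _ _) (norm_nonneg x))
  have := hstep m
  rwa [hm m le_rfl] at this

end Family

end MaxReg

/-! ### Uniformity over the parameter set -/

theorem mainTheorem8 {D X Λ : Type*}
    [NormedAddCommGroup D] [NormedSpace ℝ D] [CompleteSpace D]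
    [NormedAddCommGroup X] [NormedSpace ℝ X] [CompleteSpace X]
    (ι : D →L[ℝ] X) (hι_inj : Function.Injective ι) (hι_dense : DenseRange ι)
    (hι_compact : IsCompactOperator ι)
    (p : ENNReal) (hp_one : 1 < p) (hp_top : p < ⊤)
    (a b : ℝ) (hab : a < b)
    [MetricSpace Λ] (O : Set Λ) (hO : IsOpen O)
    (A : Λ → ℝ → D →L[ℝ] X)
    (hA_mr : ∀ t ∈ Set.Icc a b,
      (∀ l ∈ O, MaxReg.MemAutMR p ι 0 (Set.Ioi 0) (A l t)) ∧
        (⨆ l ∈ O, MaxReg.autMRConst p ι a (Set.Ioo a b) (A l t)) < ⊤)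
    (hA_equicont : MaxReg.RelEquicont ι a b (A '' O))
    (hA_bdd : ∀ t ∈ Set.Icc a b, Bornology.IsBounded ((fun l => A l t) '' O)) :
    (∀ l ∈ O, MaxReg.MemMR p ι a (Set.Ioo a b) (A l)) ∧
      (⨆ l ∈ O, MaxReg.mrConst p ι a (Set.Ioo a b) (A l)) < ⊤ := by
  have hp : 1 ≤ p := hp_one.le
  have hp' : p ≠ ⊤ := hp_top.ne
  have hba : 0 < b - a := sub_pos.2 hab
  obtain ⟨K, M, hK, hM, hKM⟩ := hA_equicont.exists_bound hp hp' hab.le (by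
    intro t ht
    -- A finite `C` strictly above the supremum exceeds an admissible constant for every λ, so the
    -- infimum need not be attained.
    obtain ⟨C, hC⟩ := ENNReal.lt_iff_exists_nnreal_btwn.1 (hA_mr t ht).2
    refine ⟨C + C / (b - a), by positivity, ?_⟩
    rintro _ ⟨l, hl, rfl⟩
    have hlt : MaxReg.mrConst p ι a (Set.Ioo a b) (fun _ => A l t) < C :=
      (le_iSup₂ (f := fun l _ => MaxReg.autMRConst p ι a (Set.Ioo a b) (A l t)) l hl).trans_lt hC.1
    simp only [MaxReg.mrConst, iInf_lt_iff] at hlt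
    obtain ⟨K, hK, hKC⟩ := hlt
    refine MaxReg.HasMRBound.hasIntegralMRBound hp hp' hab fun f hf => ?_
    obtain ⟨v, v', h1, h2, h3⟩ := hK f hf
    exact ⟨v, v', h1, h2, h3.trans (mul_le_mul_left hKC.le _)⟩) (by
    intro t ht
    obtain ⟨R, hR⟩ := (hA_bdd t ht).exists_norm_le
    -- `R` may be negative when `O` is empty.
    refine ⟨max R 0, le_max_right _ _, ?_⟩
    rintro _ ⟨l, hl, rfl⟩
    exact (hR _ (Set.mem_image_of_mem _ hl)).trans (le_max_left _ _))
  have hbound : ∀ l ∈ O, MaxReg.HasMRBound p ι a (Set.Ioo a b) (A l)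
      ((‖ι‖ + 1 + (b - a)) * K).toNNReal := fun l hl =>
    (hKM (A l) (Set.mem_image_of_mem A hl)).1.hasMRBound hp hp' hab hK
  refine ⟨fun l hl => ⟨fun x => ?_, fun t ht => ?_, _, hbound l hl⟩, ?_⟩
  · refine MeasureTheory.memLp_top_of_bound
      ((hA_equicont.1 _ (Set.mem_image_of_mem A hl)).1 x) (M * ‖x‖) ?_
    filter_upwards [MeasureTheory.ae_restrict_mem measurableSet_Ioo] with t ht
    exact (hKM (A l) (Set.mem_image_of_mem A hl)).2 t (Set.Ioo_subset_Icc_self ht) x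
  · exact ((hA_mr t (Set.Ioo_subset_Icc_self ht)).1 l hl).1
  · refine lt_of_le_of_lt (iSup₂_le fun l hl => ?_)
      (ENNReal.coe_lt_top (r := ((‖ι‖ + 1 + (b - a)) * K).toNNReal))
    exact iInf₂_le _ (hbound l hl)
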